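/- Let $T>0$ and let $(\Omega,\mathcal F,\mathbb F=(\mathcal F_t)_{t\in[0,T]},\mathbb P)$ be a filtered probability space satisfying the usual conditions. Let $L$ be a real random variable with law $\eta$, let $\mathcal G_t=\bigcap_{t<s\le T}(\mathcal F_s\vee\sigma(L))$ for $t<T$ and $\mathcal G_T=\mathcal F_T\vee\sigma(L)$, and let $\mathbb G=(\mathcal G_t)_{t\in[0,T]}$. For each $t$ let $Q_t(\omega,\mathrm dx)$ be a regular version of the conditional law of $L$ given $\mathcal F_t$. Assume Condition A: for every $t\in[0,T]$ there is a (non-random) $\sigma$-finite measure $\eta_t$ on $\mathbb R$ with $Q_t(\omega,\cdot)\ll\eta_t$ for almost every $\omega$. Let $q_t^x(\omega)\ge 0$ be a corresponding conditional density with respect to $\eta$: for each $t$, $(x,\omega)\mapsto q^x_t(\omega)$ is $\mathcal B(\mathbb R)\otimes\mathcal F_t$-measurable and $Q_t(\omega,\mathrm dx)=q_t^x(\omega)\,\eta(\mathrm dx)$ for almost every $\omega$; and for each $x$ the process $(q^x_t)_{t\in[0,T]}$ is a càdlàg $\mathbb F$-martingale. Let $(M_t)_{t\in[0,T]}$ be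 a continuous local $\mathbb F$-martingale, and let $k=k^x_t(\omega)$ be a real-valued function that is jointly progressively measurable (for each $t$, its restriction to times $s\le t$ is $\mathcal B([0,t])\otimes\mathcal F_t\otimes\mathcal B(\mathbb R)$-measurable in $(s,\omega,x)$; this holds in particular if $k$ is predictable in $(t,\omega)$ jointly with $x$) and such that for every $x\in\mathbb R$, almost surely $\int_0^T|k^x_s|\,q^x_{s-}\,\mathrm d\langle M,M\rangle_s<\infty$ and $$\langle q^x,M\rangle_t=\int_0^t k_s^x\,q_{s-}^x\,\mathrm d\langle M,M\rangle_s\qquad\text{for all }t\in[0,T].$$ Here $\langle q^x,M\rangle$ is the predictable process of finite variation, null at $0$, such that $q^xM-\langle q^x,M\rangle$ is a local $\mathbb F$-martingale, and $\langle M,M\rangle$ is the continuous nondecreasing version of the bracket of $M$ with itself. Then $\int_0^T|k^L_s|\,\mathrm d\langle M,M\rangle_s<\infty$ almost surely, the process $A_t=\int_0^t k_s^L\,\mathrm d\langle M,M\rangle_s$ is $\mathbb G$-adapted with almost surely continuous paths of finite variation, and $$M_t-\int_0^t k_s^L\,\mathrm d\langle M,M\rangle_s,\qquad t\in[0,T],$$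 is a local $\mathbb G$-martingale. Thus $M=(M-A)+A$ is the explicit $\mathbb G$-Doob–Meyer decomposition of $M$. -/

import Mathlib

open MeasureTheory ProbabilityTheory Filter Set Topology
open scoped NNReal ENNReal

noncomputable section

namespace InitialEnlargement

/-- The time interval `[0, T]`. -/
abbrev Time (T : ℝ≥0) : Type := Set.Iic T

variable {T : ℝ≥0} {Ω : Type*} {mΩ : MeasurableSpace Ω}

instance (T : ℝ≥0) : CompactIccSpace (Time T) where
  isCompact_Icc {a b} := by
    rw [Subtype.isCompact_iff]
    have h : (Subtype.val '' Set.Icc a b : Set ℝ≥0) = Set.Icc (a : ℝ≥0) (b : ℝ≥0) := by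
      ext x
      constructor
      · rintro ⟨y, hy, rfl⟩
        exact hy
      · intro hx
        exact ⟨⟨x, hx.2.trans b.2⟩, hx, rfl⟩
    rw [h]
    exact isCompact_Icc

/-- The usual conditions: `F` is right-continuous and `F 0` contains every `P`-null set
(`P s = 0` is outer measure zero, so `P` is in particular complete). -/
structure UsualConditions (F : Filtration (Time T) mΩ) (P : Measure Ω) : Prop where
  rightContinuous : F.IsRightContinuous
  complete : ∀ s : Set Ω, P s = 0 → MeasurableSet[F ⊥] s

/-- The initial enlargement `G t = ⋂_{t < s ≤ T} (F s ∨ σ(L))` for `t < T`,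
and `G T = F T ∨ σ(L)`; see the two lemmas below. -/
def enlargement (F : Filtration (Time T) mΩ) (L : Ω → ℝ) (hL : Measurable L) :
    Filtration (Time T) mΩ :=
  (F ⊔ Filtration.const (Time T) (MeasurableSpace.comap L inferInstance) hL.comap_le).rightCont

lemma enlargement_apply (F : Filtration (Time T) mΩ) (L : Ω → ℝ) (hL : Measurable L)
    (t : Time T) (ht : t < ⊤) :
    enlargement F L hL t = ⨅ s > t, F s ⊔ MeasurableSpace.comap L inferInstance := by
  rw [enlargement, Filtration.rightCont_eq_of_not_isMax _ (not_isMax_iff.2 ⟨⊤, ht⟩)]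
  rfl

lemma enlargement_top (F : Filtration (Time T) mΩ) (L : Ω → ℝ) (hL : Measurable L) :
    enlargement F L hL ⊤ = F ⊤ ⊔ MeasurableSpace.comap L inferInstance := by
  rw [enlargement, Filtration.rightCont_eq_of_isMax _ isMax_top]
  rfl

/-- Right-continuous with left limits. -/
def IsCadlag (f : Time T → ℝ) : Prop :=
  ∀ t, ContinuousWithinAt f (Ici t) t ∧ ∃ l, Tendsto f (𝓝[<] t) (𝓝 l)

/-- Càdlàg local martingale on `[0, T]`: adapted, almost surely càdlàg, and for a localizing
sequence `τ n` of stopping times each `1_{τ n > 0} X^{τ n}` is a martingale.  Stopping times take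
values in `[0, T] ∪ {⊤}` and, `T` being isolated from `⊤`, convergence `τ n → ⊤` means that almost
surely `τ n = ⊤` for all large `n`. -/
structure IsLocalMartingale (F : Filtration (Time T) mΩ) (P : Measure Ω)
    (X : Time T → Ω → ℝ) : Prop where
  adapted : StronglyAdapted F X
  cadlag : ∀ᵐ ω ∂P, IsCadlag (fun t => X t ω)
  locally_martingale : Locally (fun Y => Martingale Y F P) F X P

/-- `A` is (a version of) the predictable bracket `⟨X, Y⟩`: the predictable process of finite
variation, null at `0`, such that `X Y - A` is a local martingale. -/
structure IsBracket (F : Filtration (Time T) mΩ) (P : Measure Ω)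
    (X Y A : Time T → Ω → ℝ) : Prop where
  predictable : IsStronglyPredictable F A
  zero : ∀ᵐ ω ∂P, A ⊥ ω = 0
  cadlag : ∀ᵐ ω ∂P, IsCadlag (fun t => A t ω)
  boundedVariation : ∀ᵐ ω ∂P, BoundedVariationOn (fun t => A t ω) univ
  isLocalMartingale : IsLocalMartingale F P (fun t ω => X t ω * Y t ω - A t ω)

/-- `C` is (a version of) `⟨M, M⟩` for a continuous local martingale `M`: the bracket, with
continuous nondecreasing paths. -/
structure IsQuadraticVariation (F : Filtration (Time T) mΩ) (P : Measure Ω)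
    (M C : Time T → Ω → ℝ) : Prop extends IsBracket F P M M C where
  continuous : ∀ᵐ ω ∂P, Continuous (fun t => C t ω)
  monotone : ∀ᵐ ω ∂P, Monotone (fun t => C t ω)

open scoped Classical in
/-- The Lebesgue-Stieltjes measure `dc` on `[0, T]` of a nondecreasing path `c`
(the zero measure if `c` is not nondecreasing). It does not charge `{0}`. -/
def pathMeasure (c : Time T → ℝ) : Measure (Time T) :=
  if h : Monotone c then h.stieltjesFunction.measure else 0

/-- `κ` is a regular version of the conditional law of `L` given the sub-σ-algebra `m`. -/
structure IsRegularCondLaw (P : Measure Ω) (L : Ω → ℝ) (m : MeasurableSpace Ω)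
    (κ : @Kernel Ω ℝ m inferInstance) : Prop where
  isMarkovKernel : IsMarkovKernel κ
  condExp_eq : ∀ B : Set ℝ, MeasurableSet B →
    (fun ω => (κ ω).real B) =ᵐ[P] P[(L ⁻¹' B).indicator (fun _ => (1 : ℝ)) | m]

/-- Condition A: for all `t`, some (non-random) σ-finite measure dominates `Q_t(ω, ·)`. -/
def ConditionA (P : Measure Ω) (F : Filtration (Time T) mΩ)
    (Q : ∀ t : Time T, @Kernel Ω ℝ (F t) inferInstance) : Prop :=
  ∀ t, ∃ η : Measure ℝ, SigmaFinite η ∧ ∀ᵐ ω ∂P, Q t ω ≪ η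

/-- `q x t ω` is a version of the conditional density `q_t^x(ω)` of `Q_t(ω, dx)` with respect to
the law of `L`: nonnegative, càdlàg in `t`, `B(ℝ) ⊗ F_t`-measurable in `(x, ω)` for each `t`, and
an `F`-martingale for each fixed `x`. -/
structure IsConditionalDensity (P : Measure Ω) (F : Filtration (Time T) mΩ) (L : Ω → ℝ)
    (Q : ∀ t : Time T, @Kernel Ω ℝ (F t) inferInstance) (q : ℝ → Time T → Ω → ℝ) : Prop where
  nonneg : ∀ x t ω, 0 ≤ q x t ω
  cadlag : ∀ x ω, IsCadlag (fun t => q x t ω)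
  measurable : ∀ t, @Measurable (ℝ × Ω) ℝ (@Prod.instMeasurableSpace ℝ Ω inferInstance (F t))
    inferInstance (fun p => q p.1 t p.2)
  density : ∀ t, ∀ᵐ ω ∂P,
    Q t ω = (P.map L).withDensity (fun x => ENNReal.ofReal (q x t ω))
  martingale : ∀ x, Martingale (q x) F P

/-- Joint progressive measurability of a family of processes `k^x`: for each `t`, the map
`((s, ω), x) ↦ k_s^x(ω)` on `([0, t] × Ω) × ℝ` is `(B([0, t]) ⊗ F_t) ⊗ B(ℝ)`-measurable. -/
def IsJointlyProgressive (F : Filtration (Time T) mΩ) (k : ℝ → Time T → Ω → ℝ) : Prop :=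
  ∀ t : Time T,
    @Measurable ((Iic t × Ω) × ℝ) ℝ
      (@Prod.instMeasurableSpace (Iic t × Ω) ℝ
        (@Prod.instMeasurableSpace (Iic t) Ω inferInstance (F t)) inferInstance)
      inferInstance (fun p => k p.2 p.1.1 p.1.2)

/-- The process `∫_0^t k_s^{L} d⟨M, M⟩_s`, where `C = ⟨M, M⟩`. -/
def compensator (k : ℝ → Time T → Ω → ℝ) (L : Ω → ℝ) (C : Time T → Ω → ℝ) :
    Time T → Ω → ℝ :=
  fun t ω => ∫ s in Ioc ⊥ t, k (L ω) s ω ∂(pathMeasure (fun u => C u ω))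

end InitialEnlargement

end

/-! The joint law of `(L, ω)` on `B(ℝ) ⊗ F_T` has density `q_T^x(ω)` with respect to `η ⊗ P`. Hence
a property of `X^L`, for a process `X^x` depending on a real parameter, holds under `P` as soon as,
for every `x`, the corresponding property of `X^x` holds under the measure `q_T^x · P` on `F_T`.

Under `q_T^x · P` the assertion is Girsanov's theorem: `M - ∫ k^x d⟨M, M⟩` is a local martingale,
and `∫ |k^x| d⟨M, M⟩` is finite on `{q_T^x > 0}`. Both rest on the identity
`E ∫ f_u q_u dκ_u = E [q_T ∫ f_u dκ_u]` for a progressive process `f`, an adapted random measure `κ`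
and a right-continuous martingale `q`. To prove it, round the time `u` up to a grid of mesh
`1 / (j + 1)`: the rounded martingale is a conditional expectation of `q_T` under `P ⊗ κ`, so it is
uniformly integrable in `j` and converges in `L¹` to `q`. Since `⟨M, M⟩` is continuous, it charges
no jump of `q^x`, and `q_{s-}` may be replaced by `q_s`.

The exit times of `|M|` and `∫ |k^x| d⟨M, M⟩` from bounded sets localize `M - ∫ k^x d⟨M, M⟩` and
depend measurably on `x`, so `L` may be substituted for `x` in the stopped processes. These are
bounded and continuous, which carries the martingale property from `F_t ∨ σ(L)` over to its
right-continuous version.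
-/

noncomputable section

namespace InitialEnlargement

instance (T : ℝ≥0) : ConditionallyCompleteLinearOrder (Time T) :=
  have : Inhabited (Iic T) := ⟨⊥⟩
  ordConnectedSubsetConditionallyCompleteLinearOrder (Iic T)

section Grid

variable {T : ℝ≥0}

/-- The index of the least multiple of `1 / (j + 1)` that is at least `u`. -/
def gridIndex (j : ℕ) (u : Time T) : ℕ := ⌈(u : ℝ≥0) * (j + 1)⌉₊

/-- The time `i / (j + 1)`, truncated at `T`. -/
def gridPoint (T : ℝ≥0) (j i : ℕ) : Time T := ⟨min T (i / (j + 1)), mem_Iic.2 (min_le_left _ _)⟩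

/-- The time `u` rounded up to a multiple of `1 / (j + 1)`, truncated at `T`. Rounding up is what
makes right-continuity of the paths, and no more, suffice in the limit `j → ∞`. -/
def gridRound (j : ℕ) (u : Time T) : Time T := gridPoint T j (gridIndex j u)

lemma gridIndex_lt (j : ℕ) (u : Time T) : gridIndex j u < ⌈T * (j + 1)⌉₊ + 1 :=
  Nat.lt_succ_of_le (Nat.ceil_mono (mul_le_mul_left u.2 _))

lemma measurable_gridIndex (j : ℕ) : Measurable (gridIndex (T := T) j) := by
  have h_mono : Monotone (gridIndex (T := T) j) := fun _ _ h =>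
    Nat.ceil_mono (mul_le_mul_left (Subtype.coe_le_coe.2 h) _)
  exact h_mono.measurable

lemma measurableSet_gridIndex_eq (j i : ℕ) : MeasurableSet {u : Time T | gridIndex j u = i} :=
  measurable_gridIndex j (measurableSet_singleton i)

lemma le_gridRound (j : ℕ) (u : Time T) : u ≤ gridRound j u := by
  refine Subtype.coe_le_coe.1 (le_min (mem_Iic.1 u.2) ?_ : (u : ℝ≥0) ≤ min T _)
  rw [le_div_iff₀ (by positivity)]
  exact Nat.le_ceil _

lemma setOf_gridIndex_eq_subset (j i : ℕ) :
    {u : Time T | gridIndex j u = i} ⊆ Iic (gridPoint T j i) := by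
  rintro u rfl
  exact le_gridRound j u

lemma gridRound_le (j : ℕ) (u : Time T) : (gridRound j u : ℝ≥0) ≤ u + 1 / (j + 1) := by
  refine (min_le_right T _).trans ?_
  rw [div_le_iff₀ (by positivity), add_mul, one_div, inv_mul_cancel₀ (by positivity)]
  exact (Nat.ceil_lt_add_one (by positivity)).le

lemma tendsto_gridRound (u : Time T) : Tendsto (fun j => gridRound j u) atTop (𝓝[≥] u) := by
  refine tendsto_nhdsWithin_iff.2 ⟨tendsto_subtype_rng.2 ?_, .of_forall fun j => le_gridRound j u⟩
  have h_upper : Tendsto (fun j : ℕ => (u : ℝ≥0) + 1 / (j + 1)) atTop (𝓝 u) := by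
    simpa using (tendsto_one_div_add_atTop_nhds_zero_nat (𝕜 := ℝ≥0)).const_add (u : ℝ≥0)
  exact tendsto_of_tendsto_of_tendsto_of_le_of_le tendsto_const_nhds h_upper
    (fun j => le_gridRound j u) (fun j => gridRound_le j u)

lemma measurable_comp_natIndex {α γ β : Type*} [MeasurableSpace α] [MeasurableSpace γ]
    [MeasurableSpace β] {Y : ℕ → α → β} {g : γ → ℕ} (hY : ∀ i, Measurable (Y i))
    (hg : Measurable g) : Measurable fun p : α × γ => Y (g p.2) p.1 :=
  (measurable_from_prod_countable_left (f := fun p : α × ℕ => Y p.2 p.1) hY).comp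
    (measurable_fst.prodMk (hg.comp measurable_snd))

lemma measurable_uncurry_of_rightContinuous {α β : Type*} {mα : MeasurableSpace α}
    [TopologicalSpace β] [TopologicalSpace.PseudoMetrizableSpace β] [MeasurableSpace β]
    [BorelSpace β] {X : Time T → α → β} (hX : ∀ u, Measurable (X u))
    (hXc : ∀ a u, ContinuousWithinAt (fun v => X v a) (Ici u) u) :
    Measurable fun p : α × Time T => X p.2 p.1 := by
  refine measurable_of_tendsto_metrizable (f := fun j (p : α × Time T) => X (gridRound j p.2) p.1)
    (fun j => ?_) (tendsto_pi_nhds.2 fun p => (hXc p.1 p.2).tendsto.comp (tendsto_gridRound p.2))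
  exact measurable_comp_natIndex (fun i => hX (gridPoint T j i)) (measurable_gridIndex j)

end Grid

section PathMeasure

lemma measure_setOf_measure_Iic_le {ι : Type*} [ConditionallyCompleteLinearOrder ι] [OrderTop ι]
    [TopologicalSpace ι] [OrderTopology ι] [FirstCountableTopology ι] [MeasurableSpace ι]
    (ν : Measure ι) (c : ℝ≥0∞) : ν {u | ν (Iic u) ≤ c} ≤ c := by
  set I : Set ι := {u | ν (Iic u) ≤ c}
  rcases I.eq_empty_or_nonempty with hI | hI
  · simp [hI]
  have h_lub : IsLUB I (sSup I) := isLUB_csSup hI (OrderTop.bddAbove I)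
  by_cases h_mem : sSup I ∈ I
  · exact (measure_mono h_lub.1).trans h_mem
  obtain ⟨u, hu_mono, -, hu_lim, huI⟩ := h_lub.exists_seq_monotone_tendsto hI
  have h_cover : I ⊆ ⋃ n, Iic (u n) := fun v hv => by
    have hv_lt : v < sSup I := (h_lub.1 hv).lt_of_ne fun h => h_mem (h ▸ hv)
    obtain ⟨n, hn⟩ := (hu_lim.eventually_const_lt hv_lt).exists
    exact mem_iUnion.2 ⟨n, hn.le⟩
  refine (measure_mono h_cover).trans ?_
  have h_Iic_mono : Monotone fun n => Iic (u n) := fun _ _ h => Iic_subset_Iic.2 (hu_mono h)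
  rw [h_Iic_mono.measure_iUnion]
  exact iSup_le huI

lemma coe_stieltjesFunction_of_continuous {R : Type*} [LinearOrder R] [TopologicalSpace R]
    [OrderTopology R] {c : R → ℝ} (hc : Continuous c) (hm : Monotone c) :
    ⇑hm.stieltjesFunction = c :=
  funext fun _ => (hm.stieltjesFunction_eq _).trans hc.continuousWithinAt.rightLim_eq

variable {T : ℝ≥0} {c f : Time T → ℝ}

lemma pathMeasure_Iic (hc : Continuous c) (hm : Monotone c) (t : Time T) :
    pathMeasure c (Iic t) = ENNReal.ofReal (c t - c ⊥) := by
  have h_Icc : Iic t = Icc ⊥ t := Icc_bot.symm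
  rw [pathMeasure, dif_pos hm, h_Icc, StieltjesFunction.measure_Icc,
    leftLim_eq_of_isBot isBot_bot, coe_stieltjesFunction_of_continuous hc hm]

lemma pathMeasure_singleton (hc : Continuous c) (hm : Monotone c) (t : Time T) :
    pathMeasure c {t} = 0 := by
  have h_leftLim : Function.leftLim c t = c t := hc.continuousWithinAt.leftLim_eq
  rw [pathMeasure, dif_pos hm, StieltjesFunction.measure_singleton,
    coe_stieltjesFunction_of_continuous hc hm, h_leftLim, sub_self, ENNReal.ofReal_zero]

lemma isFiniteMeasure_pathMeasure (hc : Continuous c) (hm : Monotone c) :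
    IsFiniteMeasure (pathMeasure c) :=
  ⟨by rw [← Iic_top, pathMeasure_Iic hc hm]; exact ENNReal.ofReal_lt_top⟩

lemma IsCadlag.eventually_abs_leftLim_sub_le (hf : IsCadlag f) (t : Time T) {ε : ℝ} (hε : 0 < ε) :
    ∀ᶠ u in 𝓝[>] t, |Function.leftLim f u - f u| ≤ ε := by
  have h_near : ∀ᶠ v in 𝓝[>] t, |f v - f t| < ε / 2 :=
    (Metric.tendsto_nhds.1 (hf t).1.tendsto (ε / 2) (half_pos hε)).filter_mono
      (nhdsWithin_mono _ Ioi_subset_Ici_self)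
  filter_upwards [eventually_eventually_nhdsWithin.2 h_near, h_near, self_mem_nhdsWithin]
    with u hu_near hu htu
  rw [nhdsWithin_eq_nhds.2 (Ioi_mem_nhds htu)] at hu_near
  have : (𝓝[<] u).NeBot := nhdsLT_neBot_of_exists_lt ⟨t, htu⟩
  have h_left : |Function.leftLim f u - f t| ≤ ε / 2 :=
    le_of_tendsto ((tendsto_leftLim_of_tendsto (hf u).2).sub_const (f t)).abs
      ((hu_near.filter_mono nhdsWithin_le_nhds).mono fun _ h => h.le)
  have h_triangle := abs_sub_le (Function.leftLim f u) (f t) (f u)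
  rw [abs_sub_comm (f t)] at h_triangle
  linarith

lemma IsCadlag.countable_leftLim_ne (hf : IsCadlag f) :
    {t | Function.leftLim f t ≠ f t}.Countable := by
  have h_cover : {t | Function.leftLim f t ≠ f t} ⊆
      ⋃ n : ℕ, {t | 1 / ((n : ℝ) + 1) < |Function.leftLim f t - f t|} := fun t ht =>
    mem_iUnion.2 (exists_nat_one_div_lt (abs_pos.2 (sub_ne_zero.2 ht)))
  refine (countable_iUnion fun n => ?_).mono h_cover
  refine (countable_setOfPred_isolated_right_within
    (s := {t | 1 / ((n : ℝ) + 1) < |Function.leftLim f t - f t|})).mono fun t ht => ?_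
  refine ⟨ht, ?_⟩
  rw [inter_comm, nhdsWithin_inter', inf_principal_eq_bot]
  filter_upwards [hf.eventually_abs_leftLim_sub_le t (by positivity : 0 < 1 / ((n : ℝ) + 1))]
    with u hu using not_lt.2 hu

lemma IsCadlag.leftLim_ae_eq (hf : IsCadlag f) (ν : Measure (Time T)) [NullSingletonClass ν] :
    Function.leftLim f =ᵐ[ν] f :=
  hf.countable_leftLim_ne.measure_zero _

end PathMeasure

section AdaptedMeasure

variable {T : ℝ≥0} {Ω : Type*} {mΩ : MeasurableSpace Ω} {F : Filtration (Time T) mΩ}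
  {κ : Ω → Measure (Time T)}

/-- A random measure on `[0, T]` is adapted if the mass of `[0, t]` is `F t`-measurable. -/
def IsAdaptedMeasure (F : Filtration (Time T) mΩ) (κ : Ω → Measure (Time T)) : Prop :=
  ∀ t, Measurable[F t] fun ω => κ ω (Iic t)

namespace IsAdaptedMeasure

lemma mono {F' : Filtration (Time T) mΩ} (hκ : IsAdaptedMeasure F κ) (h : F ≤ F') :
    IsAdaptedMeasure F' κ := fun t => (hκ t).mono (h t) le_rfl

variable [∀ ω, IsFiniteMeasure (κ ω)]

lemma measurable_restrict (hκ : IsAdaptedMeasure F κ) (t : Time T) :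
    Measurable[F t] fun ω => (κ ω).restrict (Iic t) := by
  have h_Iic : ∀ r, Measurable[F t] fun ω => (κ ω).restrict (Iic t) (Iic r) := fun r => by
    simp only [Measure.restrict_apply measurableSet_Iic, Iic_inter_Iic]
    exact (hκ _).mono (F.mono (min_le_right _ _)) le_rfl
  refine @Measurable.measure_of_isPiSystem Ω (Time T) (F t) _ _ (fun ω => inferInstance) (range Iic)
    ((BorelSpace.measurable_eq (α := Time T)).trans (borel_eq_generateFrom_Iic _)) isPiSystem_Iic
    (forall_mem_range.2 h_Iic) ?_
  rw [← Iic_top]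
  exact h_Iic ⊤

lemma measurable_coe (hκ : IsAdaptedMeasure F κ) {t : Time T} {S : Set (Time T)}
    (hS : MeasurableSet S) (hSt : S ⊆ Iic t) : Measurable[F t] fun ω => κ ω S := by
  have h_restrict := (Measure.measurable_coe hS).comp (hκ.measurable_restrict t)
  simpa only [Function.comp_def, Measure.restrict_apply hS, inter_eq_left.2 hSt] using h_restrict

lemma measurable (hκ : IsAdaptedMeasure F κ) : Measurable κ := by
  simpa only [Iic_top, Measure.restrict_univ] using
    (hκ.measurable_restrict ⊤).mono (F.le ⊤) le_rfl

end IsAdaptedMeasure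

end AdaptedMeasure

section GridSigmaAlgebra

variable {T : ℝ≥0} {Ω : Type*} {mΩ : MeasurableSpace Ω} {F : Filtration (Time T) mΩ}

/-- The σ-algebra of sets `⋃ i, A i ×ˢ {u | gridIndex j u = i}` with
`A i ∈ F (gridPoint T j i)`. Given this σ-algebra, the conditional expectation of the terminal value
of a martingale is the martingale evaluated at the rounded time. -/
@[reducible] def gridSigmaAlgebra (F : Filtration (Time T) mΩ) (j : ℕ) :
    MeasurableSpace (Ω × Time T) :=
  MeasurableSpace.comap (fun p : Ω × Time T => (p.1, gridIndex j p.2))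
    (⨅ i : ℕ, (F (gridPoint T j i)).map fun ω => (ω, i))

lemma measurableSet_gridSigmaAlgebra_iff {j : ℕ} {S : Set (Ω × Time T)} :
    MeasurableSet[gridSigmaAlgebra F j] S ↔
      ∃ S' : Set (Ω × ℕ), (∀ i, MeasurableSet[F (gridPoint T j i)] {ω | (ω, i) ∈ S'}) ∧
        S = ⋃ i, {ω | (ω, i) ∈ S'} ×ˢ {u | gridIndex j u = i} := by
  have h_preimage : ∀ S' : Set (Ω × ℕ),
      (fun p : Ω × Time T => (p.1, gridIndex j p.2)) ⁻¹' S' =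
        ⋃ i, {ω | (ω, i) ∈ S'} ×ˢ {u | gridIndex j u = i} := fun S' => by ext ⟨ω, u⟩; simp
  rw [gridSigmaAlgebra, MeasurableSpace.measurableSet_comap]
  refine exists_congr fun S' => and_congr ?_ (by rw [h_preimage, eq_comm])
  simp only [MeasurableSpace.measurableSet_iInf, MeasurableSpace.map_def]
  rfl

lemma gridSigmaAlgebra_le (F : Filtration (Time T) mΩ) (j : ℕ) :
    gridSigmaAlgebra F j ≤ mΩ.prod inferInstance := by
  intro S hS
  obtain ⟨S', hS', rfl⟩ := measurableSet_gridSigmaAlgebra_iff.1 hS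
  exact .iUnion fun i => (F.le _ _ (hS' i)).prod (measurableSet_gridIndex_eq j i)

lemma stronglyMeasurable_gridSigmaAlgebra {N : Time T → Ω → ℝ} (hN : StronglyAdapted F N) (j : ℕ) :
    StronglyMeasurable[gridSigmaAlgebra F j] fun p : Ω × Time T => N (gridRound j p.2) p.1 := by
  refine Measurable.stronglyMeasurable (mα := gridSigmaAlgebra F j) fun B hB => ?_
  refine measurableSet_gridSigmaAlgebra_iff.2
    ⟨{p | N (gridPoint T j p.2) p.1 ∈ B}, fun i => (hN _).measurable hB, ?_⟩
  ext ⟨ω, u⟩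
  simp [gridRound]

lemma pairwise_disjoint_prod_gridIndex (j : ℕ) (A : ℕ → Set Ω) :
    Pairwise (Function.onFun Disjoint fun i => A i ×ˢ {u : Time T | gridIndex j u = i}) :=
  fun _ _ hab => disjoint_left.2 fun _ hp hp' => hab (hp.2.symm.trans hp'.2)

end GridSigmaAlgebra

section MartingaleAgainstAdaptedMeasure

variable {T : ℝ≥0} {Ω : Type*} {mΩ : MeasurableSpace Ω} {F : Filtration (Time T) mΩ}
  {P : Measure Ω} [IsFiniteMeasure P]

lemma quasiMeasurePreserving_fst_compProd {α : Type*} [MeasurableSpace α] {κ : Kernel Ω α}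
    [IsSFiniteKernel κ] : Measure.QuasiMeasurePreserving Prod.fst (P ⊗ₘ κ) P := by
  refine ⟨measurable_fst, .mk fun s hs hs_null => ?_⟩
  rw [Measure.map_apply measurable_fst hs, ← Set.prod_univ,
    Measure.compProd_apply_prod hs .univ, setLIntegral_measure_zero _ _ hs_null]

lemma norm_kernel_real_le {α β : Type*} [MeasurableSpace α] [MeasurableSpace β] (κ : Kernel α β)
    [IsFiniteKernel κ] (a : α) (s : Set β) : ‖(κ a).real s‖ ≤ κ.bound.toReal := by
  rw [Real.norm_of_nonneg measureReal_nonneg]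
  exact ENNReal.toReal_mono κ.bound_ne_top (κ.measure_le_bound a _)

lemma integrable_comp_fst_compProd {α : Type*} [MeasurableSpace α] {κ : Kernel Ω α}
    [IsFiniteKernel κ] {f : Ω → ℝ} (hf : Integrable f P) :
    Integrable (fun p : Ω × α => f p.1) (P ⊗ₘ κ) := by
  have h_meas : AEStronglyMeasurable (fun p : Ω × α => f p.1) (P ⊗ₘ κ) :=
    hf.aestronglyMeasurable.comp_quasiMeasurePreserving quasiMeasurePreserving_fst_compProd
  rw [Measure.integrable_compProd_iff h_meas]
  refine ⟨ae_of_all _ fun ω => integrable_const (f ω), ?_⟩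
  simp only [integral_const, smul_eq_mul]
  exact hf.norm.bdd_mul (κ.measurable_coe .univ).ennreal_toReal.aestronglyMeasurable
    (ae_of_all _ fun ω => norm_kernel_real_le κ ω univ)

variable {N : Time T → Ω → ℝ} {κ : Kernel Ω (Time T)} [IsFiniteKernel κ]

lemma setIntegral_martingale_gridRound (hN : Martingale N F P) (hκ : IsAdaptedMeasure F κ)
    (j i : ℕ) {A : Set Ω} (hA : MeasurableSet[F (gridPoint T j i)] A) :
    ∫ p in A ×ˢ {u | gridIndex j u = i}, N (gridRound j p.2) p.1 ∂(P ⊗ₘ κ) =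
      ∫ p in A ×ˢ {u | gridIndex j u = i}, N ⊤ p.1 ∂(P ⊗ₘ κ) := by
  set t := gridPoint T j i
  set E := {u : Time T | gridIndex j u = i}
  have hA' : MeasurableSet A := F.le _ _ hA
  have hE : MeasurableSet E := measurableSet_gridIndex_eq j i
  have h_int : ∀ u, Integrable (fun p : Ω × Time T => N u p.1) (P ⊗ₘ κ) := fun u =>
    integrable_comp_fst_compProd (hN.integrable u)
  set g : Ω → ℝ := fun ω => (κ ω).real E
  have hg : StronglyMeasurable[F t] g :=
    (hκ.measurable_coe hE (setOf_gridIndex_eq_subset j i)).ennreal_toReal.stronglyMeasurable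
  have hg_mul : Integrable (g * N ⊤) P :=
    (hN.integrable ⊤).bdd_mul (hg.mono (F.le t)).aestronglyMeasurable
      (ae_of_all _ fun ω => norm_kernel_real_le κ ω E)
  have h_condExp : P[g * N ⊤ | F t] =ᵐ[P] g * N t :=
    (condExp_mul_of_stronglyMeasurable_left hg hg_mul (hN.integrable ⊤)).trans
      ((ae_eq_refl g).mul (hN.2 t ⊤ le_top))
  calc ∫ p in A ×ˢ E, N (gridRound j p.2) p.1 ∂(P ⊗ₘ κ)
      = ∫ p in A ×ˢ E, N t p.1 ∂(P ⊗ₘ κ) :=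
        setIntegral_congr_fun (hA'.prod hE) fun p hp => by
          simp only [gridRound, show gridIndex j p.2 = i from hp.2, t]
    _ = ∫ ω in A, g ω * N t ω ∂P := by
        rw [Measure.setIntegral_compProd hA' hE (h_int _).integrableOn]
        simp only [setIntegral_const, smul_eq_mul, g]
    _ = ∫ ω in A, (P[g * N ⊤ | F t]) ω ∂P :=
        (setIntegral_congr_ae hA' (h_condExp.mono fun ω h _ => h)).symm
    _ = ∫ ω in A, g ω * N ⊤ ω ∂P := setIntegral_condExp (F.le t) hg_mul hA
    _ = ∫ p in A ×ˢ E, N ⊤ p.1 ∂(P ⊗ₘ κ) := by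
        rw [Measure.setIntegral_compProd hA' hE (h_int _).integrableOn]
        simp only [setIntegral_const, smul_eq_mul, g]

lemma integrable_martingale_gridRound (hN : Martingale N F P) (j : ℕ) :
    Integrable (fun p : Ω × Time T => N (gridRound j p.2) p.1) (P ⊗ₘ κ) := by
  have h_cover : (univ : Set (Ω × Time T)) =
      ⋃ i ∈ Finset.range (⌈T * (j + 1)⌉₊ + 1), (univ ×ˢ {u | gridIndex j u = i}) := by
    refine (eq_univ_of_forall fun p => ?_).symm
    simpa using gridIndex_lt j p.2
  rw [← integrableOn_univ, h_cover, integrableOn_finset_iUnion]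
  intro i _
  have h_fixed := (integrable_comp_fst_compProd (κ := κ)
    (hN.integrable (gridPoint T j i))).integrableOn (s := univ ×ˢ {u | gridIndex j u = i})
  refine h_fixed.congr_fun (fun p hp => ?_)
    (MeasurableSet.univ.prod (measurableSet_gridIndex_eq j i))
  simp only [gridRound, show gridIndex j p.2 = i from hp.2]

lemma martingale_gridRound_ae_eq_condExp (hN : Martingale N F P) (hκ : IsAdaptedMeasure F κ)
    (j : ℕ) :
    (fun p : Ω × Time T => N (gridRound j p.2) p.1) =ᵐ[P ⊗ₘ κ]
      (P ⊗ₘ κ)[fun p => N ⊤ p.1 | gridSigmaAlgebra F j] := by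
  have h_grid := integrable_martingale_gridRound (κ := κ) hN j
  have h_top : Integrable (fun p : Ω × Time T => N ⊤ p.1) (P ⊗ₘ κ) :=
    integrable_comp_fst_compProd (hN.integrable ⊤)
  refine ae_eq_condExp_of_forall_setIntegral_eq (gridSigmaAlgebra_le F j) h_top
    (fun S _ _ => h_grid.integrableOn) (fun S hS _ => ?_)
    (stronglyMeasurable_gridSigmaAlgebra hN.1 j).aestronglyMeasurable
  obtain ⟨S', hS', rfl⟩ := measurableSet_gridSigmaAlgebra_iff.1 hS
  have h_meas : ∀ i, MeasurableSet ({ω | (ω, i) ∈ S'} ×ˢ {u : Time T | gridIndex j u = i}) :=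
    fun i => (F.le _ _ (hS' i)).prod (measurableSet_gridIndex_eq j i)
  have h_disj := pairwise_disjoint_prod_gridIndex (T := T) j fun i => {ω | (ω, i) ∈ S'}
  rw [integral_iUnion h_meas h_disj h_grid.integrableOn,
    integral_iUnion h_meas h_disj h_top.integrableOn]
  exact tsum_congr fun i => setIntegral_martingale_gridRound hN hκ j i (hS' i)

lemma uniformIntegrable_martingale_gridRound (hN : Martingale N F P) (hκ : IsAdaptedMeasure F κ) :
    UniformIntegrable (fun j (p : Ω × Time T) => N (gridRound j p.2) p.1) 1 (P ⊗ₘ κ) :=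
  ((integrable_comp_fst_compProd (hN.integrable ⊤)).uniformIntegrable_condExp
    (gridSigmaAlgebra_le F)).ae_eq fun j => (martingale_gridRound_ae_eq_condExp hN hκ j).symm

lemma integrable_martingale_compProd (hN : Martingale N F P)
    (hc : ∀ ω u, ContinuousWithinAt (fun v => N v ω) (Ici u) u) (hκ : IsAdaptedMeasure F κ) :
    Integrable (fun p : Ω × Time T => N p.2 p.1) (P ⊗ₘ κ) :=
  memLp_one_iff_integrable.1
    ((uniformIntegrable_martingale_gridRound hN hκ).memLp_of_ae_tendsto
      (ae_of_all _ fun p => (hc p.1 p.2).tendsto.comp (tendsto_gridRound p.2)))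

theorem integral_martingale_compProd (hN : Martingale N F P)
    (hc : ∀ ω u, ContinuousWithinAt (fun v => N v ω) (Ici u) u) (hκ : IsAdaptedMeasure F κ) :
    ∫ p, N p.2 p.1 ∂(P ⊗ₘ κ) = ∫ p, N ⊤ p.1 ∂(P ⊗ₘ κ) := by
  have h_int := integrable_martingale_compProd hN hc hκ
  have h_tendsto_L1 := tendsto_Lp_finite_of_tendsto_ae le_rfl ENNReal.one_ne_top
    (fun j => (integrable_martingale_gridRound hN j).aestronglyMeasurable)
    (memLp_one_iff_integrable.2 h_int) (uniformIntegrable_martingale_gridRound hN hκ).unifIntegrable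
    (ae_of_all _ fun p => (hc p.1 p.2).tendsto.comp (tendsto_gridRound p.2))
  have h_tendsto := tendsto_integral_of_L1' _ h_int.aestronglyMeasurable
    (.of_forall fun j => integrable_martingale_gridRound hN j) h_tendsto_L1
  refine tendsto_nhds_unique h_tendsto (tendsto_const_nhds.congr fun j => ?_)
  rw [integral_congr_ae (martingale_gridRound_ae_eq_condExp hN hκ j),
    integral_condExp (gridSigmaAlgebra_le F j)]

end MartingaleAgainstAdaptedMeasure

section MeasureFamily

variable {α β : Type*} {mα : MeasurableSpace α} {mβ : MeasurableSpace β}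

instance isSFiniteKernel_of_isFiniteMeasure (κ : Kernel α β) [∀ a, IsFiniteMeasure (κ a)] :
    IsSFiniteKernel κ := by
  classical
  set level : α → ℕ := fun a => ⌊(κ a univ).toNNReal⌋₊
  have h_level : ∀ n, MeasurableSet {a | level a = n} := fun n =>
    Nat.measurable_floor.comp (κ.measurable_coe .univ).ennreal_toNNReal (measurableSet_singleton n)
  refine ⟨fun n => Kernel.piecewise (h_level n) κ 0,
    fun n => ⟨⟨n + 1, by finiteness, fun a => ?_⟩⟩, ?_⟩
  · rw [Kernel.piecewise_apply]
    split_ifs with ha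
    · rw [← ENNReal.coe_toNNReal (measure_ne_top (κ a) univ), ← show level a = n from ha]
      exact_mod_cast (Nat.lt_floor_add_one (κ a univ).toNNReal).le
    · simp
  · ext a s hs
    rw [Kernel.sum_apply' _ _ hs, tsum_eq_single (level a), Kernel.piecewise_apply', if_pos]
    · rfl
    · intro n hn
      rw [Kernel.piecewise_apply', if_neg fun h => hn h.symm]
      simp

variable {ν : α → Measure β} [∀ a, IsFiniteMeasure (ν a)]

lemma measurable_lintegral_family (hν : Measurable ν) {f : α × β → ℝ≥0∞} (hf : Measurable f) :
    Measurable fun a => ∫⁻ u, f (a, u) ∂ν a := by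
  let κ : Kernel α β := ⟨ν, hν⟩
  have : ∀ a, IsFiniteMeasure (κ a) := fun a => inferInstanceAs (IsFiniteMeasure (ν a))
  exact hf.lintegral_kernel_prod_right' (κ := κ)

lemma measurable_integral_family (hν : Measurable ν) {f : α × β → ℝ} (hf : Measurable f) :
    Measurable fun a => ∫ u, f (a, u) ∂ν a := by
  let κ : Kernel α β := ⟨ν, hν⟩
  have : ∀ a, IsFiniteMeasure (κ a) := fun a => inferInstanceAs (IsFiniteMeasure (ν a))
  exact (hf.stronglyMeasurable.integral_kernel_prod_right' (κ := κ)).measurable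

variable [LinearOrder β] [TopologicalSpace β] [OrderClosedTopology β] [SecondCountableTopology β]
  [OpensMeasurableSpace β] {τ : α → β}

lemma measurableSet_setOf_snd_le (hτ : Measurable τ) :
    MeasurableSet {p : α × β | p.2 ≤ τ p.1} :=
  measurableSet_le measurable_snd (hτ.comp measurable_fst)

lemma measurable_setLIntegral_Iic_family (hν : Measurable ν) (hτ : Measurable τ)
    {f : α × β → ℝ≥0∞} (hf : Measurable f) :
    Measurable fun a => ∫⁻ s in Iic (τ a), f (a, s) ∂ν a := by
  have h_ind := measurable_lintegral_family hν (hf.indicator (measurableSet_setOf_snd_le hτ))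
  convert h_ind using 2 with a
  rw [← lintegral_indicator measurableSet_Iic]
  congr! 2 with s

lemma measurable_setIntegral_Iic_family (hν : Measurable ν) (hτ : Measurable τ)
    {f : α × β → ℝ} (hf : Measurable f) :
    Measurable fun a => ∫ s in Iic (τ a), f (a, s) ∂ν a := by
  have h_ind := measurable_integral_family hν (hf.indicator (measurableSet_setOf_snd_le hτ))
  convert h_ind using 2 with a
  rw [← integral_indicator measurableSet_Iic]
  congr! 2 with s

end MeasureFamily

section Progressive

variable {T : ℝ≥0} {Ω : Type*} {mΩ : MeasurableSpace Ω} {F : Filtration (Time T) mΩ}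
  {β : Type*} {mβ : MeasurableSpace β}

lemma measurableSpace_prod_mono {α γ : Type*} {m₁ m₂ : MeasurableSpace α}
    {n₁ n₂ : MeasurableSpace γ} (hm : m₁ ≤ m₂) (hn : n₁ ≤ n₂) : m₁.prod n₁ ≤ m₂.prod n₂ :=
  sup_le_sup (MeasurableSpace.comap_mono hm) (MeasurableSpace.comap_mono hn)

lemma isProgressive_iff_measurable_min {f : Time T → Ω → β} :
    IsProgressive F f ↔
      ∀ t, Measurable[(F t).prod inferInstance] fun p : Ω × Time T => f (min p.2 t) p.1 := by
  refine forall_congr' fun t => ⟨fun h => ?_, fun h => ?_⟩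
  · have h_pair : Measurable[(F t).prod inferInstance, Subtype.instMeasurableSpace.prod (F t)]
        fun p : Ω × Time T => ((⟨min p.2 t, mem_Iic.2 (min_le_right _ _)⟩ : Iic t), p.1) :=
      Measurable.prodMk (((measurable_id.min measurable_const).comp
        (@measurable_snd _ _ (F t) _)).subtype_mk) (@measurable_fst _ _ (F t) _)
    exact h.comp h_pair
  · have h_pair : Measurable[Subtype.instMeasurableSpace.prod (F t), (F t).prod inferInstance]
        fun p : Iic t × Ω => (p.2, (p.1 : Time T)) :=
      Measurable.prodMk (@measurable_snd _ _ _ (F t))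
        (measurable_subtype_coe.comp (@measurable_fst _ _ _ (F t)))
    convert h.comp h_pair using 2 with p
    simp only [Function.comp_apply, min_eq_left (mem_Iic.1 p.1.2)]

lemma measurable_uncurry_of_isProgressive {f : Time T → Ω → β} (hf : IsProgressive F f) :
    Measurable fun p : Ω × Time T => f p.2 p.1 := by
  simpa using (isProgressive_iff_measurable_min.1 hf ⊤).mono
    (measurableSpace_prod_mono (F.le ⊤) le_rfl) le_rfl

lemma isProgressive_mono {F' : Filtration (Time T) mΩ} (h : F ≤ F') {f : Time T → Ω → β}
    (hf : IsProgressive F f) : IsProgressive F' f := fun t =>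
  (hf t).mono (measurableSpace_prod_mono le_rfl (h t)) le_rfl

lemma isProgressive_ite_le [Zero β] {f : Time T → Ω → β} {V : Time T → Ω → ℝ≥0∞}
    (hf : IsProgressive F f) (hV : IsProgressive F V) (c : ℝ≥0∞) :
    IsProgressive F fun t ω => if V t ω ≤ c then f t ω else 0 := fun t =>
  Measurable.ite ((hV t) measurableSet_Iic) (hf t) measurable_const

lemma isProgressive_of_rightContinuous [TopologicalSpace β]
    [TopologicalSpace.PseudoMetrizableSpace β] [BorelSpace β] {X : Time T → Ω → β}
    (hX : ∀ t, Measurable[F t] (X t))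
    (hc : ∀ ω u, ContinuousWithinAt (fun v => X v ω) (Ici u) u) : IsProgressive F X := by
  refine isProgressive_iff_measurable_min.2 fun t => ?_
  refine measurable_uncurry_of_rightContinuous (X := fun u ω => X (min u t) ω) (mα := F t)
    (fun u => (hX _).mono (F.mono (min_le_right _ _)) le_rfl) fun ω u => ?_
  have h_min : ContinuousWithinAt (fun v : Time T => min v t) (Ici u) u :=
    (continuous_id.min continuous_const).continuousWithinAt
  exact ContinuousWithinAt.comp (g := fun v => X v ω) (t := Ici (min u t)) (hc ω _) h_min
    fun v hv => min_le_min_right t hv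

variable {κ : Ω → Measure (Time T)} [∀ ω, IsFiniteMeasure (κ ω)]

lemma isProgressive_setLIntegral_Iic {f : Time T → Ω → ℝ≥0∞} (hf : IsProgressive F f)
    (hκ : IsAdaptedMeasure F κ) : IsProgressive F fun t ω => ∫⁻ s in Iic t, f s ω ∂κ ω := by
  refine isProgressive_iff_measurable_min.2 fun t => ?_
  have h_meas := measurable_setLIntegral_Iic_family (mα := (F t).prod inferInstance)
    (ν := fun p : Ω × Time T => (κ p.1).restrict (Iic t)) (τ := fun p => min p.2 t)
    (f := fun p => f (min p.2 t) p.1.1)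
    ((hκ.measurable_restrict t).comp (@measurable_fst _ _ (F t) _))
    ((@measurable_snd _ _ (F t) _).min measurable_const)
    ((isProgressive_iff_measurable_min.1 hf t).comp
      (Measurable.prodMk (measurable_fst.comp measurable_fst) measurable_snd))
  convert h_meas using 2 with p
  rw [Measure.restrict_restrict measurableSet_Iic, Iic_inter_Iic, min_assoc, min_self]
  refine setLIntegral_congr_fun measurableSet_Iic fun s hs => ?_
  rw [min_eq_left ((mem_Iic.1 hs).trans (min_le_right _ _))]

lemma isProgressive_setIntegral_Iic {f : Time T → Ω → ℝ} (hf : IsProgressive F f)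
    (hκ : IsAdaptedMeasure F κ) : IsProgressive F fun t ω => ∫ s in Iic t, f s ω ∂κ ω := by
  refine isProgressive_iff_measurable_min.2 fun t => ?_
  have h_meas := measurable_setIntegral_Iic_family (mα := (F t).prod inferInstance)
    (ν := fun p : Ω × Time T => (κ p.1).restrict (Iic t)) (τ := fun p => min p.2 t)
    (f := fun p => f (min p.2 t) p.1.1)
    ((hκ.measurable_restrict t).comp (@measurable_fst _ _ (F t) _))
    ((@measurable_snd _ _ (F t) _).min measurable_const)
    ((isProgressive_iff_measurable_min.1 hf t).comp
      (Measurable.prodMk (measurable_fst.comp measurable_fst) measurable_snd))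
  convert h_meas using 2 with p
  rw [Measure.restrict_restrict measurableSet_Iic, Iic_inter_Iic, min_assoc, min_self]
  refine setIntegral_congr_fun measurableSet_Iic fun s hs => ?_
  simp only [min_eq_left ((mem_Iic.1 hs).trans (min_le_right _ _))]

lemma isAdaptedMeasure_withDensity {f : Time T → Ω → ℝ≥0∞} (hf : IsProgressive F f)
    (hκ : IsAdaptedMeasure F κ) :
    IsAdaptedMeasure F fun ω => (κ ω).withDensity fun u => f u ω := fun t => by
  simpa only [withDensity_apply _ measurableSet_Iic]
    using (isProgressive_setLIntegral_Iic hf hκ).adapted t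

lemma isProgressive_measure_Iic (hκ : IsAdaptedMeasure F κ) :
    IsProgressive F fun t ω => κ ω (Iic t) := by
  simpa using isProgressive_setLIntegral_Iic (isProgressive_const F 1) hκ

end Progressive

section ProgressiveProjection

variable {T : ℝ≥0} {Ω : Type*} {mΩ : MeasurableSpace Ω} {F : Filtration (Time T) mΩ}

/-- The process `f`, capped at `j` and set to zero once `κ` has accumulated more mass than `j`.
It approximates `f` from below by processes with bounded integrals against `κ`. -/
def truncate (κ : Ω → Measure (Time T)) (f : Time T → Ω → ℝ≥0∞) (j : ℕ) :
    Time T → Ω → ℝ≥0∞ :=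
  fun t ω => if κ ω (Iic t) ≤ j then min (f t ω) j else 0

section Truncate

variable {κ : Ω → Measure (Time T)} {f : Time T → Ω → ℝ≥0∞}

lemma monotone_truncate : Monotone (truncate κ f) := by
  intro i j hij t ω
  have h_cast : (i : ℝ≥0∞) ≤ j := by exact_mod_cast hij
  by_cases h : κ ω (Iic t) ≤ i
  · simpa only [truncate, if_pos h, if_pos (h.trans h_cast)] using min_le_min_left _ h_cast
  · simp [truncate, h]

lemma lintegral_truncate_le (j : ℕ) (ω : Ω) : ∫⁻ t, truncate κ f j t ω ∂κ ω ≤ j * j :=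
  calc ∫⁻ t, truncate κ f j t ω ∂κ ω
      ≤ ∫⁻ t, {t | κ ω (Iic t) ≤ j}.indicator (fun _ => (j : ℝ≥0∞)) t ∂κ ω := by
        refine lintegral_mono fun t => ?_
        by_cases h : κ ω (Iic t) ≤ j <;> simp [truncate, h, indicator]
    _ ≤ j * κ ω {t | κ ω (Iic t) ≤ j} := lintegral_indicator_const_le _ _
    _ ≤ j * j := by gcongr; exact measure_setOf_measure_Iic_le _ _

variable [∀ ω, IsFiniteMeasure (κ ω)]

lemma iSup_truncate (t : Time T) (ω : Ω) : ⨆ j, truncate κ f j t ω = f t ω := by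
  refine iSup_eq_of_tendsto (fun _ _ h => monotone_truncate h t ω) ?_
  have h_min : Tendsto (fun j : ℕ => min (f t ω) (j : ℝ≥0∞)) atTop (𝓝 (min (f t ω) ∞)) :=
    tendsto_const_nhds.min ENNReal.tendsto_nat_nhds_top
  rw [min_eq_left le_top] at h_min
  obtain ⟨n, hn⟩ := ENNReal.exists_nat_gt (measure_ne_top (κ ω) (Iic t))
  refine h_min.congr' ?_
  filter_upwards [eventually_ge_atTop n] with j hj
  rw [truncate, if_pos (hn.le.trans (by exact_mod_cast hj))]

lemma isProgressive_truncate (hκ : IsAdaptedMeasure F κ) (hf : IsProgressive F f) (j : ℕ) :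
    IsProgressive F (truncate κ f j) :=
  isProgressive_ite_le (fun t => (hf t).min measurable_const) (isProgressive_measure_Iic hκ) j

end Truncate

variable {P : Measure Ω} {q : Time T → Ω → ℝ}

lemma measurable_martingale_uncurry (hq : Martingale q F P)
    (hc : ∀ ω u, ContinuousWithinAt (fun v => q v ω) (Ici u) u) :
    Measurable fun p : Ω × Time T => q p.2 p.1 :=
  measurable_uncurry_of_isProgressive
    (isProgressive_of_rightContinuous (fun t => (hq.1 t).measurable) hc)

lemma measurable_martingale_top (hq : Martingale q F P) :
    Measurable fun p : Ω × Time T => q ⊤ p.1 :=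
  ((hq.1 ⊤).mono (F.le ⊤)).measurable.comp measurable_fst

variable [IsFiniteMeasure P] {κ : Kernel Ω (Time T)} [∀ ω, IsFiniteMeasure (κ ω)]

lemma lintegral_progressive_mul_martingale_of_le (hq : Martingale q F P)
    (hc : ∀ ω u, ContinuousWithinAt (fun v => q v ω) (Ici u) u) (h0 : ∀ u ω, 0 ≤ q u ω)
    (hκ : IsAdaptedMeasure F κ) {f : Time T → Ω → ℝ≥0∞} (hf : IsProgressive F f)
    {c : ℝ≥0∞} (hc_top : c ≠ ∞) (hfc : ∀ ω, ∫⁻ u, f u ω ∂κ ω ≤ c) :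
    ∫⁻ p, f p.2 p.1 * ENNReal.ofReal (q p.2 p.1) ∂(P ⊗ₘ κ) =
      ∫⁻ p, f p.2 p.1 * ENNReal.ofReal (q ⊤ p.1) ∂(P ⊗ₘ κ) := by
  have hf_meas : Measurable fun p : Ω × Time T => f p.2 p.1 :=
    measurable_uncurry_of_isProgressive hf
  set κf := κ.withDensity fun ω u => f u ω
  have hκf_apply : ∀ ω, κf ω = (κ ω).withDensity fun u => f u ω :=
    κ.withDensity_apply hf_meas
  have : IsFiniteKernel κf := ⟨⟨c, hc_top.lt_top, fun ω => by simpa [hκf_apply] using hfc ω⟩⟩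
  have hκf : IsAdaptedMeasure F κf := fun t => by
    simpa only [hκf_apply] using isAdaptedMeasure_withDensity hf hκ t
  have h_lintegral : ∀ g : Ω × Time T → ℝ, Measurable g →
      ∫⁻ p, ENNReal.ofReal (g p) ∂(P ⊗ₘ κf) =
        ∫⁻ p, f p.2 p.1 * ENNReal.ofReal (g p) ∂(P ⊗ₘ κ) := fun g hg => by
    rw [Measure.lintegral_compProd hg.ennreal_ofReal,
      Measure.lintegral_compProd (f := fun p => f p.2 p.1 * ENNReal.ofReal (g p))
        (hf_meas.mul hg.ennreal_ofReal)]
    exact lintegral_congr fun ω => Kernel.lintegral_withDensity κ (f := fun ω u => f u ω) hf_meas ω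
      (hg.comp measurable_prodMk_left).ennreal_ofReal
  rw [← h_lintegral _ (measurable_martingale_uncurry hq hc),
    ← h_lintegral _ (measurable_martingale_top hq),
    ← ofReal_integral_eq_lintegral_ofReal (integrable_martingale_compProd hq hc hκf)
      (ae_of_all _ fun p => h0 _ _),
    ← ofReal_integral_eq_lintegral_ofReal (integrable_comp_fst_compProd (hq.integrable ⊤))
      (ae_of_all _ fun p => h0 _ _), integral_martingale_compProd hq hc hκf]

theorem lintegral_progressive_mul_martingale (hq : Martingale q F P)
    (hc : ∀ ω u, ContinuousWithinAt (fun v => q v ω) (Ici u) u) (h0 : ∀ u ω, 0 ≤ q u ω)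
    (hκ : IsAdaptedMeasure F κ) {f : Time T → Ω → ℝ≥0∞} (hf : IsProgressive F f) :
    ∫⁻ p, f p.2 p.1 * ENNReal.ofReal (q p.2 p.1) ∂(P ⊗ₘ κ) =
      ∫⁻ p, f p.2 p.1 * ENNReal.ofReal (q ⊤ p.1) ∂(P ⊗ₘ κ) := by
  have h_iSup : ∀ r : Ω × Time T → ℝ, Measurable r →
      ∫⁻ p, f p.2 p.1 * ENNReal.ofReal (r p) ∂(P ⊗ₘ κ) =
        ⨆ j, ∫⁻ p, truncate κ f j p.2 p.1 * ENNReal.ofReal (r p) ∂(P ⊗ₘ κ) := fun r hr => by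
    rw [← lintegral_iSup]
    · simp only [← ENNReal.iSup_mul, iSup_truncate]
    · exact fun j => (measurable_uncurry_of_isProgressive (isProgressive_truncate hκ hf j)).mul
        hr.ennreal_ofReal
    · exact fun i j hij p => mul_le_mul_left (monotone_truncate hij _ _) _
  rw [h_iSup _ (measurable_martingale_uncurry hq hc), h_iSup _ (measurable_martingale_top hq)]
  exact iSup_congr fun j => lintegral_progressive_mul_martingale_of_le hq hc h0 hκ
    (isProgressive_truncate hκ hf j) (by finiteness) (lintegral_truncate_le j)

lemma integrable_progressive_mul_martingale (hq : Martingale q F P)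
    (hc : ∀ ω u, ContinuousWithinAt (fun v => q v ω) (Ici u) u) (h0 : ∀ u ω, 0 ≤ q u ω)
    (hκ : IsAdaptedMeasure F κ) {f : Time T → Ω → ℝ} (hf : IsProgressive F f)
    (hf_int : Integrable (fun p => f p.2 p.1 * q ⊤ p.1) (P ⊗ₘ κ)) :
    Integrable (fun p => f p.2 p.1 * q p.2 p.1) (P ⊗ₘ κ) := by
  refine ⟨((measurable_uncurry_of_isProgressive hf).mul
    (measurable_martingale_uncurry hq hc)).aestronglyMeasurable, ?_⟩
  have h_top := hf_int.2
  rw [HasFiniteIntegral] at h_top ⊢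
  simp only [enorm_mul, Real.enorm_eq_ofReal (h0 _ _)] at h_top ⊢
  rwa [lintegral_progressive_mul_martingale (f := fun t ω => ‖f t ω‖ₑ) hq hc h0 hκ
    fun t => measurable_enorm.comp (hf t)]

theorem integral_progressive_mul_martingale (hq : Martingale q F P)
    (hc : ∀ ω u, ContinuousWithinAt (fun v => q v ω) (Ici u) u) (h0 : ∀ u ω, 0 ≤ q u ω)
    (hκ : IsAdaptedMeasure F κ) {f : Time T → Ω → ℝ} (hf : IsProgressive F f)
    (hf_int : Integrable (fun p => f p.2 p.1 * q ⊤ p.1) (P ⊗ₘ κ)) :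
    ∫ p, f p.2 p.1 * q p.2 p.1 ∂(P ⊗ₘ κ) = ∫ p, f p.2 p.1 * q ⊤ p.1 ∂(P ⊗ₘ κ) := by
  rw [integral_eq_lintegral_pos_part_sub_lintegral_neg_part
      (integrable_progressive_mul_martingale hq hc h0 hκ hf hf_int),
    integral_eq_lintegral_pos_part_sub_lintegral_neg_part hf_int]
  simp only [← neg_mul, ENNReal.ofReal_mul' (h0 _ _)]
  rw [lintegral_progressive_mul_martingale (f := fun t ω => ENNReal.ofReal (f t ω)) hq hc h0 hκ
      fun t => ENNReal.measurable_ofReal.comp (hf t),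
    lintegral_progressive_mul_martingale (f := fun t ω => ENNReal.ofReal (-f t ω)) hq hc h0 hκ
      fun t => ENNReal.measurable_ofReal.comp (measurable_neg.comp (hf t))]

lemma lintegral_ite_setLIntegral_Iic_le (ν : Measure (Time T)) (g : Time T → ℝ≥0∞) (c : ℝ≥0∞) :
    ∫⁻ u, (if ∫⁻ s in Iic u, g s ∂ν ≤ c then g u else 0) ∂ν ≤ c := by
  have h_density : ∀ u, ∫⁻ s in Iic u, g s ∂ν = ν.withDensity g (Iic u) := fun u =>
    (withDensity_apply _ measurableSet_Iic).symm
  simp only [h_density]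
  calc ∫⁻ u, (if ν.withDensity g (Iic u) ≤ c then g u else 0) ∂ν
      = ∫⁻ u, {u | ν.withDensity g (Iic u) ≤ c}.indicator g u ∂ν := by
        refine lintegral_congr fun u => ?_
        by_cases h : ν.withDensity g (Iic u) ≤ c <;>
          simp only [indicator, mem_ofPred_eq, h, if_true, if_false]
    _ ≤ ∫⁻ u in {u | ν.withDensity g (Iic u) ≤ c}, g u ∂ν := lintegral_indicator_le _ _
    _ ≤ ν.withDensity g {u | ν.withDensity g (Iic u) ≤ c} := withDensity_apply_le _ _
    _ ≤ c := measure_setOf_measure_Iic_le _ _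

theorem lintegral_lt_top_of_martingale_pos (hq : Martingale q F P)
    (hc : ∀ ω u, ContinuousWithinAt (fun v => q v ω) (Ici u) u) (h0 : ∀ u ω, 0 ≤ q u ω)
    (hκ : IsAdaptedMeasure F κ) {f : Time T → Ω → ℝ≥0∞} (hf : IsProgressive F f)
    (hfin : ∀ᵐ ω ∂P, ∫⁻ u, f u ω * ENNReal.ofReal (q u ω) ∂κ ω < ∞) :
    ∀ᵐ ω ∂P, 0 < q ⊤ ω → ∫⁻ u, f u ω ∂κ ω < ∞ := by
  have hq_prog : IsProgressive F q :=
    isProgressive_of_rightContinuous (fun t => (hq.1 t).measurable) hc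
  set U : Time T → Ω → ℝ≥0∞ := fun t ω => ∫⁻ u in Iic t, f u ω * ENNReal.ofReal (q u ω) ∂κ ω
  have hU : IsProgressive F U :=
    isProgressive_setLIntegral_Iic (fun t => (hf t).mul (hq_prog t).ennreal_ofReal) hκ
  set fU : ℕ → Time T → Ω → ℝ≥0∞ := fun j t ω => if U t ω ≤ j then f t ω else 0
  have hfU : ∀ j, IsProgressive F (fU j) := fun j => isProgressive_ite_le hf hU j
  have h_fin : ∀ j : ℕ, ∀ᵐ ω ∂P, ∫⁻ u, fU j u ω * ENNReal.ofReal (q ⊤ ω) ∂κ ω < ∞ := by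
    intro j
    have h_meas : ∀ r : Ω × Time T → ℝ, Measurable r →
        Measurable fun p => fU j p.2 p.1 * ENNReal.ofReal (r p) := fun r hr =>
      (measurable_uncurry_of_isProgressive (hfU j)).mul hr.ennreal_ofReal
    have h_top := h_meas _ (measurable_martingale_top hq)
    refine ae_lt_top (h_top.lintegral_kernel_prod_right' (κ := κ)) (ne_of_lt ?_)
    calc ∫⁻ ω, ∫⁻ u, fU j u ω * ENNReal.ofReal (q ⊤ ω) ∂κ ω ∂P
        = ∫⁻ ω, ∫⁻ u, fU j u ω * ENNReal.ofReal (q u ω) ∂κ ω ∂P := by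
          rw [← Measure.lintegral_compProd (f := fun p => fU j p.2 p.1 * ENNReal.ofReal (q ⊤ p.1))
              h_top, ← lintegral_progressive_mul_martingale hq hc h0 hκ (hfU j),
            Measure.lintegral_compProd (h_meas _ (measurable_martingale_uncurry hq hc))]
      _ ≤ ∫⁻ _, j ∂P := lintegral_mono fun ω => by
          simpa only [fU, ite_mul, zero_mul] using lintegral_ite_setLIntegral_Iic_le (κ ω) _ j
      _ < ∞ := by rw [lintegral_const]; finiteness
  filter_upwards [ae_all_iff.2 h_fin, hfin] with ω h_fin_ω hfin_ω hpos
  obtain ⟨n, hn⟩ := ENNReal.exists_nat_gt hfin_ω.ne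
  have hU_le : ∀ u, U u ω ≤ n := fun u => (setLIntegral_le_lintegral _ _).trans hn.le
  have h_mul := h_fin_ω n
  simp only [fU, hU_le, if_true] at h_mul
  rw [lintegral_mul_const' _ _ ENNReal.ofReal_ne_top] at h_mul
  exact ENNReal.lt_top_of_mul_ne_top_left h_mul.ne (ENNReal.ofReal_pos.2 hpos).ne'

end ProgressiveProjection

section CapTime

variable {T : ℝ≥0}

/-- The time `t ∧ σ`, as an element of `[0, T]`. -/
def capTime (σ : WithTop (Time T)) (t : Time T) : Time T := (min (t : WithTop (Time T)) σ).untopA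

variable {σ : WithTop (Time T)} {s t : Time T}

lemma coe_capTime (σ : WithTop (Time T)) (t : Time T) :
    (capTime σ t : WithTop (Time T)) = min (t : WithTop (Time T)) σ := by
  have h_ne_top : min (t : WithTop (Time T)) σ ≠ ⊤ :=
    ne_top_of_le_ne_top WithTop.coe_ne_top (min_le_left _ _)
  rw [capTime, WithTop.untopA_eq_untop h_ne_top, WithTop.coe_untop]

lemma capTime_le (σ : WithTop (Time T)) (t : Time T) : capTime σ t ≤ t :=
  WithTop.coe_le_coe.1 ((coe_capTime σ t).trans_le (min_le_left _ _))

lemma coe_capTime_le (σ : WithTop (Time T)) (t : Time T) : (capTime σ t : WithTop (Time T)) ≤ σ :=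
  (coe_capTime σ t).trans_le (min_le_right _ _)

lemma le_capTime_iff : s ≤ capTime σ t ↔ s ≤ t ∧ (s : WithTop (Time T)) ≤ σ := by
  rw [← WithTop.coe_le_coe, coe_capTime, le_min_iff, WithTop.coe_le_coe]

lemma capTime_of_le (h : (t : WithTop (Time T)) ≤ σ) : capTime σ t = t :=
  le_antisymm (capTime_le _ _) (le_capTime_iff.2 ⟨le_rfl, h⟩)

lemma capTime_coe (s t : Time T) : capTime (s : WithTop (Time T)) t = min t s :=
  eq_of_forall_le_iff fun r => by rw [le_capTime_iff, le_min_iff, WithTop.coe_le_coe]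

lemma capTime_congr_of_le (hst : s ≤ t) (h : σ ≤ (s : WithTop (Time T))) :
    capTime σ t = capTime σ s :=
  eq_of_forall_le_iff fun r => by
    simp only [le_capTime_iff, and_congr_left_iff]
    intro hr
    have hrs : r ≤ s := WithTop.coe_le_coe.1 (hr.trans h)
    exact ⟨fun _ => hrs, fun _ => hrs.trans hst⟩

lemma monotone_capTime (σ : WithTop (Time T)) : Monotone (capTime σ) := fun _ _ h =>
  le_capTime_iff.2 ⟨(capTime_le _ _).trans h, coe_capTime_le _ _⟩

lemma continuous_capTime (σ : WithTop (Time T)) : Continuous (capTime σ) := by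
  induction σ with
  | top => exact continuous_id.congr fun t => (capTime_of_le le_top).symm
  | coe r => exact (continuous_id.min continuous_const).congr fun t => (capTime_coe r t).symm

variable {Ω : Type*} {mΩ : MeasurableSpace Ω} {F : Filtration (Time T) mΩ}

lemma isStoppingTime_capTime {σ : Ω → WithTop (Time T)} (hσ : IsStoppingTime F σ) (t : Time T) :
    IsStoppingTime F fun ω => (capTime (σ ω) t : WithTop (Time T)) := by
  simpa only [coe_capTime] using (isStoppingTime_const F t).min hσ

end CapTime

section Localized

variable {T : ℝ≥0} {Ω : Type*} {X : Time T → Ω → ℝ} {σ : Ω → WithTop (Time T)} {ω : Ω}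
  {s t : Time T}

/-- The process `1_{σ > 0} X^σ` that appears in Mathlib's definition of a local property. -/
def localized (X : Time T → Ω → ℝ) (σ : Ω → WithTop (Time T)) : Time T → Ω → ℝ :=
  stoppedProcess (fun t => {ω | ⊥ < σ ω}.indicator (X t)) σ

lemma localized_of_bot_lt (h : ⊥ < σ ω) (t : Time T) :
    localized X σ t ω = X (capTime (σ ω) t) ω :=
  indicator_of_mem (s := {ω | ⊥ < σ ω}) h _

lemma localized_of_not_bot_lt (h : ¬ ⊥ < σ ω) (t : Time T) : localized X σ t ω = 0 :=
  indicator_of_notMem (s := {ω | ⊥ < σ ω}) h _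

lemma localized_congr {ρ : Ω → WithTop (Time T)} (h : σ ω = ρ ω) :
    localized X σ t ω = localized X ρ t ω := by
  by_cases hσ : ⊥ < σ ω
  · rw [localized_of_bot_lt hσ, localized_of_bot_lt (h ▸ hσ), h]
  · rw [localized_of_not_bot_lt hσ, localized_of_not_bot_lt (h ▸ hσ)]

lemma localized_of_le (h : ⊥ < σ ω) (ht : (t : WithTop (Time T)) ≤ σ ω) :
    localized X σ t ω = X t ω := by
  rw [localized_of_bot_lt h, capTime_of_le ht]

lemma localized_congr_of_le (hst : s ≤ t) (h : σ ω ≤ (s : WithTop (Time T))) :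
    localized X σ t ω = localized X σ s ω := by
  by_cases hσ : ⊥ < σ ω
  · rw [localized_of_bot_lt hσ, localized_of_bot_lt hσ, capTime_congr_of_le hst h]
  · rw [localized_of_not_bot_lt hσ, localized_of_not_bot_lt hσ]

lemma continuousWithinAt_Ici_localized (hX : ∀ t, ContinuousWithinAt (fun v => X v ω) (Ici t) t)
    (t : Time T) : ContinuousWithinAt (fun v => localized X σ v ω) (Ici t) t := by
  by_cases h : ⊥ < σ ω
  · simp only [localized_of_bot_lt h]
    exact ContinuousWithinAt.comp (t := Ici (capTime (σ ω) t)) (hX _)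
      (continuous_capTime _).continuousWithinAt fun v hv => monotone_capTime _ hv
  · simp only [localized_of_not_bot_lt h]
    exact continuousWithinAt_const

end Localized

section ProgressiveIndicator

variable {T : ℝ≥0} {Ω : Type*} {mΩ : MeasurableSpace Ω} {F : Filtration (Time T) mΩ}
  {f : Time T → Ω → ℝ}

lemma isProgressive_indicator_prod (hf : IsProgressive F f) {s : Time T} {B : Set Ω}
    (hB : MeasurableSet[F s] B) {S : Set (Time T)} (hS : MeasurableSet S) (hsS : S ⊆ Ici s) :
    IsProgressive F fun t ω => (B ×ˢ S).indicator (fun p => f p.2 p.1) (ω, t) := by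
  intro t
  have h_set : MeasurableSet[Subtype.instMeasurableSpace.prod (F t)]
      {p : Iic t × Ω | (p.2, (p.1 : Time T)) ∈ B ×ˢ S} := by
    rcases le_or_gt s t with hst | hts
    · exact ((@measurable_snd _ _ _ (F t)) (F.mono hst _ hB)).inter
        ((measurable_subtype_coe.comp (@measurable_fst _ _ _ (F t))) hS)
    · convert @MeasurableSet.empty _ (Subtype.instMeasurableSpace.prod (F t))
      exact eq_empty_of_forall_notMem fun p hp =>
        (hts.trans_le (hsS hp.2)).not_ge (mem_Iic.1 p.1.2)
  exact (hf t).indicator h_set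

lemma measurable_min_of_isStoppingTime {τ : Ω → Time T}
    (hτ : IsStoppingTime F fun ω => (τ ω : WithTop (Time T))) (t : Time T) :
    Measurable[F t] fun ω => min (τ ω) t := by
  refine measurable_of_Iic fun r => ?_
  rcases le_or_gt t r with htr | hrt
  · convert @MeasurableSet.univ _ (F t)
    ext ω
    simp [htr]
  · convert F.mono hrt.le _ (hτ r) using 1
    ext ω
    simp [hrt.not_ge]

lemma isProgressive_indicator_Iic (hf : IsProgressive F f) {τ : Ω → Time T}
    (hτ : IsStoppingTime F fun ω => (τ ω : WithTop (Time T))) :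
    IsProgressive F fun t ω => (Iic (τ ω)).indicator (fun u => f u ω) t := by
  intro t
  have h_time : Measurable[Subtype.instMeasurableSpace.prod (F t)]
      fun p : Iic t × Ω => (p.1 : Time T) :=
    measurable_subtype_coe.comp (@measurable_fst _ _ _ (F t))
  have h_min : Measurable[Subtype.instMeasurableSpace.prod (F t)]
      fun p : Iic t × Ω => min (τ p.2) t :=
    (measurable_min_of_isStoppingTime hτ t).comp (@measurable_snd _ _ _ (F t))
  convert (hf t).indicator (measurableSet_le h_time h_min) using 2 with p
  simp [indicator, mem_Iic.1 p.1.2]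

end ProgressiveIndicator

section OptionalSampling

variable {T : ℝ≥0} {Ω : Type*} {mΩ : MeasurableSpace Ω} {F : Filtration (Time T) mΩ}
  {τ : Ω → Time T}

lemma measurable_of_isStoppingTime
    (hτ : IsStoppingTime F fun ω => (τ ω : WithTop (Time T))) : Measurable τ := by
  simpa using (measurable_min_of_isStoppingTime hτ ⊤).mono (F.le ⊤) le_rfl

lemma measurable_progressive_stopped {f : Time T → Ω → ℝ} (hf : IsProgressive F f)
    (hτ : IsStoppingTime F fun ω => (τ ω : WithTop (Time T))) :
    Measurable[hτ.measurableSpace] fun ω => f (τ ω) ω :=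
  measurable_stoppedValue hf.isStronglyProgressive hτ

lemma measurableSet_of_forall_le {s : Time T} {B : Set Ω}
    (hτ : IsStoppingTime F fun ω => (τ ω : WithTop (Time T))) (hB : MeasurableSet[F s] B)
    (hsτ : ∀ ω ∈ B, s ≤ τ ω) : MeasurableSet[hτ.measurableSpace] B := by
  have hs := isStoppingTime_const F s
  have h_inter := hs.measurableSet_inter_le hτ B (by rwa [IsStoppingTime.measurableSpace_const])
  have h_eq : B ∩ {ω | (s : WithTop (Time T)) ≤ τ ω} = B :=
    inter_eq_left.2 fun ω hω => WithTop.coe_le_coe.2 (hsτ ω hω)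
  rw [h_eq] at h_inter
  exact IsStoppingTime.measurableSpace_mono (hs.min hτ) hτ (fun ω => min_le_right _ _) _ h_inter

lemma isStoppingTime_ite_top {B : Set Ω} [DecidablePred (· ∈ B)]
    (hτ : IsStoppingTime F fun ω => (τ ω : WithTop (Time T)))
    (hB : MeasurableSet[hτ.measurableSpace] B) :
    IsStoppingTime F fun ω => ((if ω ∈ B then τ ω else ⊤ : Time T) : WithTop (Time T)) := by
  intro t
  simp only [WithTop.coe_le_coe]
  have h_split : {ω | (if ω ∈ B then τ ω else ⊤) ≤ t} =
      B ∩ {ω | (τ ω : WithTop (Time T)) ≤ t} ∪ Bᶜ ∩ {_ω | ⊤ ≤ t} := by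
    ext ω
    by_cases hω : ω ∈ B <;> simp [hω]
  rw [h_split]
  refine (hB.2 t).union ?_
  by_cases ht : ⊤ ≤ t
  · obtain rfl : t = ⊤ := top_le_iff.1 ht
    simpa using (hτ.measurableSpace_le_of_le_const fun ω => WithTop.coe_le_coe.2 le_top) _ hB
  · simp [ht]

variable {P : Measure Ω} [IsFiniteMeasure P] {N : Time T → Ω → ℝ}

lemma integral_martingale_stopped (hN : Martingale N F P)
    (hc : ∀ ω t, ContinuousWithinAt (fun v => N v ω) (Ici t) t)
    (hτ : IsStoppingTime F fun ω => (τ ω : WithTop (Time T))) :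
    Integrable (fun ω => N (τ ω) ω) P ∧ ∫ ω, N (τ ω) ω ∂P = ∫ ω, N ⊤ ω ∂P := by
  have hτm := measurable_of_isStoppingTime hτ
  have h_adapted : IsAdaptedMeasure F (Kernel.deterministic τ hτm) := fun t => by
    simp only [Kernel.deterministic_apply, Measure.dirac_apply' _ measurableSet_Iic]
    have h_le : MeasurableSet[F t] {ω | τ ω ≤ t} := by simpa only [WithTop.coe_le_coe] using hτ t
    exact (@measurable_const ℝ≥0∞ _ _ (F t) 1).indicator h_le
  have h_graph : Measurable fun ω => (ω, τ ω) := measurable_id.prodMk hτm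
  have h_int := integrable_martingale_compProd hN hc h_adapted
  have h_mean := integral_martingale_compProd hN hc h_adapted
  rw [Measure.compProd_deterministic] at h_int h_mean
  rw [integral_map h_graph.aemeasurable h_int.aestronglyMeasurable, integral_map
    h_graph.aemeasurable (measurable_martingale_top hN).aestronglyMeasurable] at h_mean
  exact ⟨h_int.comp_measurable h_graph, h_mean⟩

theorem martingale_stopped_ae_eq_condExp (hN : Martingale N F P)
    (hc : ∀ ω t, ContinuousWithinAt (fun v => N v ω) (Ici t) t)
    (hτ : IsStoppingTime F fun ω => (τ ω : WithTop (Time T))) :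
    (fun ω => N (τ ω) ω) =ᵐ[P] P[N ⊤ | hτ.measurableSpace] := by
  classical
  have h_le : hτ.measurableSpace ≤ mΩ := hτ.measurableSpace_le
  obtain ⟨h_int, -⟩ := integral_martingale_stopped hN hc hτ
  refine ae_eq_condExp_of_forall_setIntegral_eq h_le (hN.integrable ⊤)
    (fun B _ _ => h_int.integrableOn) (fun B hB _ => ?_)
    (measurable_progressive_stopped (isProgressive_of_rightContinuous
      (fun t => (hN.stronglyAdapted t).measurable) hc) hτ).stronglyMeasurable.aestronglyMeasurable
  obtain ⟨h_int', h_mean⟩ := integral_martingale_stopped hN hc (isStoppingTime_ite_top hτ hB)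
  have h_B := h_le _ hB
  rw [← integral_add_compl h_B h_int', ← integral_add_compl h_B (hN.integrable ⊤)] at h_mean
  have h_on : ∫ ω in B, N (if ω ∈ B then τ ω else ⊤) ω ∂P = ∫ ω in B, N (τ ω) ω ∂P :=
    setIntegral_congr_fun h_B fun ω hω => by simp only [if_pos hω]
  have h_off : ∫ ω in Bᶜ, N (if ω ∈ B then τ ω else ⊤) ω ∂P = ∫ ω in Bᶜ, N ⊤ ω ∂P :=
    setIntegral_congr_fun h_B.compl fun ω hω => by simp only [if_neg hω]
  rw [h_on, h_off] at h_mean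
  exact add_right_cancel h_mean

end OptionalSampling

lemma setIntegral_mul_eq_of_ae_eq_condExp {Ω : Type*} {m mΩ : MeasurableSpace Ω} {P : Measure Ω}
    [IsFiniteMeasure P] (hm : m ≤ mΩ) {Z g h : Ω → ℝ} (hh : Integrable h P)
    (hg : g =ᵐ[P] P[h | m]) {B : Set Ω} (hB : MeasurableSet[m] B) (hZ : Measurable[m] Z) {c : ℝ}
    (hZc : ∀ ω ∈ B, ‖Z ω‖ ≤ c) :
    IntegrableOn (fun ω => g ω * Z ω) B P ∧ IntegrableOn (fun ω => h ω * Z ω) B P ∧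
      ∫ ω in B, g ω * Z ω ∂P = ∫ ω in B, h ω * Z ω ∂P := by
  have hBm := hm _ hB
  have hZm : Measurable Z := hZ.mono hm le_rfl
  have h_bound : ∀ᵐ ω ∂P.restrict B, ‖Z ω‖ ≤ c := (ae_restrict_iff' hBm).2 (ae_of_all _ hZc)
  have h_int : ∀ {g : Ω → ℝ}, Integrable g P → IntegrableOn (fun ω => g ω * Z ω) B P :=
    fun hg => hg.restrict.mul_bdd hZm.aestronglyMeasurable h_bound
  have hg_int : Integrable g P := integrable_condExp.congr hg.symm
  refine ⟨h_int hg_int, h_int hh, ?_⟩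
  have h_indicator : ∀ g : Ω → ℝ, g * B.indicator Z = B.indicator fun ω => g ω * Z ω := fun g => by
    ext ω
    exact (indicator_mul_right B g Z).symm
  have h_pull : P[h * B.indicator Z | m] =ᵐ[P] P[h | m] * B.indicator Z :=
    condExp_mul_of_stronglyMeasurable_right (hZ.indicator hB).stronglyMeasurable
      (by rw [h_indicator]; exact (h_int hh).integrable_indicator hBm) hh
  rw [← integral_indicator hBm, ← integral_indicator hBm, ← h_indicator, ← h_indicator,
    ← integral_condExp hm (f := h * _)]
  exact integral_congr_ae ((hg.mul (ae_eq_refl _)).trans h_pull.symm)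

lemma integrableOn_setIntegral_compProd {α β : Type*} [MeasurableSpace α] [MeasurableSpace β]
    {μ : Measure α} [SFinite μ] {κ : Kernel α β} [IsSFiniteKernel κ] {f : α × β → ℝ} {B : Set α}
    {S : Set β} (hB : MeasurableSet B) (hS : MeasurableSet S)
    (hf : IntegrableOn f (B ×ˢ S) (μ ⊗ₘ κ)) :
    IntegrableOn (fun a => ∫ b in S, f (a, b) ∂κ a) B μ := by
  rw [← integrable_indicator_iff hB]
  have h_int := Integrable.integral_compProd (hf.integrable_indicator (hB.prod hS))
  refine h_int.congr (ae_of_all _ fun a => ?_)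
  simp only [Kernel.prodMkLeft_apply]
  by_cases ha : a ∈ B
  · rw [indicator_of_mem ha, ← integral_indicator hS]
    exact integral_congr_ae (ae_of_all _ fun b => by by_cases hb : b ∈ S <;> simp [ha, hb])
  · simp [ha]

section Increment

variable {T : ℝ≥0} {Ω : Type*} {mΩ : MeasurableSpace Ω} {F : Filtration (Time T) mΩ}
  {P : Measure Ω} [IsFiniteMeasure P] {q M K : Time T → Ω → ℝ} {κ : Kernel Ω (Time T)}
  [∀ ω, IsFiniteMeasure (κ ω)] {s : Time T} {B : Set Ω} {c : ℝ≥0}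

lemma integrableOn_prod_mul_martingale_top (hq : Martingale q F P) (hK : IsProgressive F K)
    (hB : MeasurableSet B) {S : Set (Time T)} (hS : MeasurableSet S)
    (hKc : ∀ ω ∈ B, ∫⁻ u in S, ‖K u ω‖ₑ ∂κ ω ≤ c) :
    IntegrableOn (fun p => K p.2 p.1 * q ⊤ p.1) (B ×ˢ S) (P ⊗ₘ κ) := by
  have h_meas : Measurable fun p : Ω × Time T => K p.2 p.1 * q ⊤ p.1 :=
    (measurable_uncurry_of_isProgressive hK).mul (measurable_martingale_top hq)
  refine ⟨h_meas.aestronglyMeasurable, ?_⟩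
  rw [HasFiniteIntegral, Measure.setLIntegral_compProd h_meas.enorm hB hS]
  calc ∫⁻ ω in B, ∫⁻ u in S, ‖K u ω * q ⊤ ω‖ₑ ∂κ ω ∂P
      ≤ ∫⁻ ω in B, c * ‖q ⊤ ω‖ₑ ∂P := by
        refine setLIntegral_mono' hB fun ω hω => ?_
        simp only [enorm_mul]
        rw [lintegral_mul_const' _ _ enorm_ne_top]
        gcongr
        exact hKc ω hω
    _ = c * ∫⁻ ω in B, ‖q ⊤ ω‖ₑ ∂P := lintegral_const_mul' _ _ ENNReal.coe_ne_top
    _ < ∞ := ENNReal.mul_lt_top ENNReal.coe_lt_top (hq.integrable ⊤).restrict.2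

lemma setIntegral_progressive_mul_martingale (hq : Martingale q F P)
    (hc : ∀ ω t, ContinuousWithinAt (fun v => q v ω) (Ici t) t) (h0 : ∀ t ω, 0 ≤ q t ω)
    (hκ : IsAdaptedMeasure F κ) (hK : IsProgressive F K) (hB : MeasurableSet[F s] B)
    {S : Set (Time T)} (hS : MeasurableSet S) (hsS : S ⊆ Ici s)
    (hKc : ∀ ω ∈ B, ∫⁻ u in S, ‖K u ω‖ₑ ∂κ ω ≤ c) :
    IntegrableOn (fun ω => ∫ u in S, K u ω * q u ω ∂κ ω) B P ∧
      IntegrableOn (fun ω => q ⊤ ω * ∫ u in S, K u ω ∂κ ω) B P ∧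
      ∫ ω in B, ∫ u in S, K u ω * q u ω ∂κ ω ∂P =
        ∫ ω in B, q ⊤ ω * ∫ u in S, K u ω ∂κ ω ∂P := by
  have hBm := F.le s _ hB
  have hBS : MeasurableSet (B ×ˢ S) := hBm.prod hS
  have h_top := integrableOn_prod_mul_martingale_top (κ := κ) hq hK hBm hS hKc
  have h_indicator : ∀ r : Ω × Time T → ℝ,
      (fun p => (B ×ˢ S).indicator (fun p => K p.2 p.1) p * r p) =
        (B ×ˢ S).indicator fun p => K p.2 p.1 * r p := fun r =>
    funext fun p => (indicator_mul_left _ _ _).symm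
  have h_prog := isProgressive_indicator_prod hK hB hS hsS
  have h_top' : Integrable (fun p => (B ×ˢ S).indicator (fun p => K p.2 p.1) p * q ⊤ p.1)
      (P ⊗ₘ κ) := by
    rw [h_indicator fun p => q ⊤ p.1]
    exact h_top.integrable_indicator hBS
  have h_int := integrable_progressive_mul_martingale hq hc h0 hκ h_prog h_top'
  have h_eq := integral_progressive_mul_martingale hq hc h0 hκ h_prog h_top'
  simp only [Prod.mk.eta] at h_int h_eq
  rw [h_indicator fun p => q p.2 p.1, integrable_indicator_iff hBS] at h_int
  rw [h_indicator fun p => q p.2 p.1, h_indicator fun p => q ⊤ p.1, integral_indicator hBS,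
    integral_indicator hBS, Measure.setIntegral_compProd hBm hS h_int,
    Measure.setIntegral_compProd hBm hS h_top] at h_eq
  have h_const : ∀ ω, ∫ u in S, K u ω * q ⊤ ω ∂κ ω = q ⊤ ω * ∫ u in S, K u ω ∂κ ω := fun ω => by
    rw [integral_mul_const, mul_comm]
  simp only [h_const] at h_eq
  have h_top_int := integrableOn_setIntegral_compProd hBm hS h_top
  simp only [h_const] at h_top_int
  exact ⟨integrableOn_setIntegral_compProd hBm hS h_int, h_top_int, h_eq⟩

lemma setIntegral_Ioc_mul_martingale (hq : Martingale q F P)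
    (hc : ∀ ω t, ContinuousWithinAt (fun v => q v ω) (Ici t) t) (h0 : ∀ t ω, 0 ≤ q t ω)
    (hκ : IsAdaptedMeasure F κ) (hK : IsProgressive F K) (hB : MeasurableSet[F s] B)
    {τ : Ω → Time T} (hτ : IsStoppingTime F fun ω => (τ ω : WithTop (Time T)))
    (hKc : ∀ ω ∈ B, ∫⁻ u in Ioc s (τ ω), ‖K u ω‖ₑ ∂κ ω ≤ c) :
    IntegrableOn (fun ω => ∫ u in Ioc s (τ ω), K u ω * q u ω ∂κ ω) B P ∧
      IntegrableOn (fun ω => q ⊤ ω * ∫ u in Ioc s (τ ω), K u ω ∂κ ω) B P ∧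
      ∫ ω in B, ∫ u in Ioc s (τ ω), K u ω * q u ω ∂κ ω ∂P =
        ∫ ω in B, q ⊤ ω * ∫ u in Ioc s (τ ω), K u ω ∂κ ω ∂P := by
  have h_integral : ∀ ω (g : Time T → ℝ),
      ∫ u in Ioi s, (Iic (τ ω)).indicator g u ∂κ ω = ∫ u in Ioc s (τ ω), g u ∂κ ω :=
    fun ω g => by rw [setIntegral_indicator measurableSet_Iic, Ioi_inter_Iic]
  have h_bound : ∀ ω ∈ B, ∫⁻ u in Ioi s, ‖(Iic (τ ω)).indicator (fun u => K u ω) u‖ₑ ∂κ ω ≤ c :=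
    fun ω hω => by
      simp only [enorm_indicator_eq_indicator_enorm]
      rw [setLIntegral_indicator measurableSet_Iic, inter_comm, Ioi_inter_Iic]
      exact hKc ω hω
  have h_main := setIntegral_progressive_mul_martingale hq hc h0 hκ
    (isProgressive_indicator_Iic hK hτ) hB measurableSet_Ioi Ioi_subset_Ici_self h_bound
  have h_mul : ∀ ω u, (Iic (τ ω)).indicator (fun u => K u ω) u * q u ω =
      (Iic (τ ω)).indicator (fun u => K u ω * q u ω) u := fun ω u =>
    (indicator_mul_left _ (fun u => K u ω) fun u => q u ω).symm
  simpa only [h_mul, h_integral] using h_main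

lemma setIntegral_increment_mul_martingale (hq : Martingale q F P)
    (hc : ∀ ω t, ContinuousWithinAt (fun v => q v ω) (Ici t) t) (h0 : ∀ t ω, 0 ≤ q t ω)
    (hκ : IsAdaptedMeasure F κ) (hK : IsProgressive F K) (hM : IsProgressive F M)
    (hB : MeasurableSet[F s] B)
    {τ : Ω → Time T} (hτ : IsStoppingTime F fun ω => (τ ω : WithTop (Time T)))
    (hsτ : ∀ ω ∈ B, s ≤ τ ω) (hMs : ∀ ω ∈ B, ‖M s ω‖ ≤ c) (hMτ : ∀ ω ∈ B, ‖M (τ ω) ω‖ ≤ c)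
    (hKc : ∀ ω ∈ B, ∫⁻ u in Ioc s (τ ω), ‖K u ω‖ₑ ∂κ ω ≤ c) :
    IntegrableOn (fun ω => q ⊤ ω * (M (τ ω) ω - M s ω - ∫ u in Ioc s (τ ω), K u ω ∂κ ω)) B P ∧
      ∫ ω in B, q (τ ω) ω * M (τ ω) ω - q s ω * M s ω -
          ∫ u in Ioc s (τ ω), K u ω * q u ω ∂κ ω ∂P =
        ∫ ω in B, q ⊤ ω * (M (τ ω) ω - M s ω - ∫ u in Ioc s (τ ω), K u ω ∂κ ω) ∂P := by
  have hBτ := measurableSet_of_forall_le hτ hB hsτ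
  obtain ⟨hK_int, hK_int', hK_eq⟩ := setIntegral_Ioc_mul_martingale hq hc h0 hκ hK hB hτ hKc
  obtain ⟨hs_int, hs_int', hs_eq⟩ := setIntegral_mul_eq_of_ae_eq_condExp (F.le s)
    (hq.integrable ⊤) (hq.condExp_ae_eq le_top).symm hB (hM.adapted s) hMs
  obtain ⟨hτ_int, hτ_int', hτ_eq⟩ := setIntegral_mul_eq_of_ae_eq_condExp hτ.measurableSpace_le
    (hq.integrable ⊤) (martingale_stopped_ae_eq_condExp hq hc hτ) hBτ
    (measurable_progressive_stopped hM hτ) hMτ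
  simp only [mul_sub]
  refine ⟨(hτ_int'.fun_sub hs_int').sub hK_int', ?_⟩
  rw [integral_sub (hτ_int.fun_sub hs_int) hK_int, integral_sub hτ_int hs_int,
    integral_sub (hτ_int'.fun_sub hs_int') hK_int', integral_sub hτ_int' hs_int', hτ_eq, hs_eq,
    hK_eq]

end Increment

lemma setIntegral_Iic_sub_setIntegral_Iic {β : Type*} [LinearOrder β] [TopologicalSpace β]
    [OrderClosedTopology β] [MeasurableSpace β] [OpensMeasurableSpace β] {ν : Measure β} {g : β → ℝ}
    {s t : β} (hst : s ≤ t) (hg : IntegrableOn g (Iic t) ν) :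
    ∫ u in Iic t, g u ∂ν - ∫ u in Iic s, g u ∂ν = ∫ u in Ioc s t, g u ∂ν := by
  rw [← Iic_union_Ioc_eq_Iic hst, setIntegral_union (Iic_disjoint_Ioc le_rfl) measurableSet_Ioc
    (hg.mono_set (Iic_subset_Iic.2 hst)) (hg.mono_set Ioc_subset_Iic_self), add_sub_cancel_left]

section Girsanov

variable {T : ℝ≥0} {Ω : Type*} {M K : Time T → Ω → ℝ} {c : ℝ≥0} {s t : Time T} {ω : Ω}

section Compensated

variable {κ : Ω → Measure (Time T)} {σ ρ : Ω → WithTop (Time T)}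

/-- The process `M - ∫ K dκ` whose martingale property is at stake. -/
def compensated (κ : Ω → Measure (Time T)) (M K : Time T → Ω → ℝ) (t : Time T) (ω : Ω) : ℝ :=
  M t ω - ∫ u in Iic t, K u ω ∂κ ω

/-- Up to the random time `σ`, if it is positive, both `|M|` and the total variation of `∫ K dκ`
are at most `c`. -/
def IsBoundedUpTo (κ : Ω → Measure (Time T)) (M K : Time T → Ω → ℝ) (c : ℝ≥0)
    (σ : Ω → WithTop (Time T)) : Prop :=
  ∀ ω, ⊥ < σ ω → ∀ u : Time T, (u : WithTop (Time T)) ≤ σ ω →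
    ‖M u ω‖ ≤ c ∧ ∫⁻ v in Iic u, ‖K v ω‖ₑ ∂κ ω ≤ c

lemma IsBoundedUpTo.mono (hσ : IsBoundedUpTo κ M K c σ) (hρσ : ρ ≤ σ) :
    IsBoundedUpTo κ M K c ρ := fun ω hω u hu =>
  hσ ω (hω.trans_le (hρσ ω)) u (hu.trans (hρσ ω))

lemma IsBoundedUpTo.lintegral_Ioc_le (hσ : IsBoundedUpTo κ M K c σ) (hω : ⊥ < σ ω)
    (ht : (t : WithTop (Time T)) ≤ σ ω) : ∫⁻ u in Ioc s t, ‖K u ω‖ₑ ∂κ ω ≤ c :=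
  (lintegral_mono_set Ioc_subset_Iic_self).trans (hσ ω hω t ht).2

lemma localized_compensated_sub_of_lt (hσ : IsBoundedUpTo κ M K c σ)
    (hK : Measurable fun u => K u ω) (hst : s ≤ t) (hsσ : (s : WithTop (Time T)) < σ ω) :
    localized (compensated κ M K) σ t ω - localized (compensated κ M K) σ s ω =
      M (capTime (σ ω) t) ω - M s ω - ∫ u in Ioc s (capTime (σ ω) t), K u ω ∂κ ω := by
  have hω : ⊥ < σ ω := bot_le.trans_lt hsσ
  have h_int : IntegrableOn (fun u => K u ω) (Iic (capTime (σ ω) t)) (κ ω) :=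
    ⟨hK.aestronglyMeasurable,
      (hσ ω hω _ (coe_capTime_le _ _)).2.trans_lt ENNReal.coe_lt_top⟩
  rw [localized_of_bot_lt hω, localized_of_bot_lt hω, capTime_of_le hsσ.le,
    ← setIntegral_Iic_sub_setIntegral_Iic (le_capTime_iff.2 ⟨hst, hsσ.le⟩) h_int]
  simp only [compensated]
  ring

lemma norm_localized_compensated_le (hσ : IsBoundedUpTo κ M K c σ) (t : Time T) :
    ‖localized (compensated κ M K) σ t ω‖ ≤ 2 * c := by
  by_cases hω : ⊥ < σ ω
  · obtain ⟨hM, hK⟩ := hσ ω hω _ (coe_capTime_le (σ ω) t)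
    have h_integral : ‖∫ u in Iic (capTime (σ ω) t), K u ω ∂κ ω‖ ≤ c := by
      rw [← coe_nnnorm, NNReal.coe_le_coe, ← ENNReal.coe_le_coe]
      exact (enorm_integral_le_lintegral_enorm _).trans hK
    rw [localized_of_bot_lt hω, two_mul]
    exact (norm_sub_le _ _).trans (add_le_add hM h_integral)
  · rw [localized_of_not_bot_lt hω, norm_zero]
    positivity

end Compensated

variable {mΩ : MeasurableSpace Ω} {F : Filtration (Time T) mΩ} {P : Measure Ω} [IsFiniteMeasure P]
  {q N : Time T → Ω → ℝ} {κ : Kernel Ω (Time T)} [∀ ω, IsFiniteMeasure (κ ω)]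
  {σ ρ : Ω → WithTop (Time T)} {A : Set Ω}

lemma measurable_localized {X : Time T → Ω → ℝ} (hX : IsProgressive F X)
    (hσ : IsStoppingTime F σ) (t : Time T) : Measurable[F t] (localized X σ t) := by
  have hτ := isStoppingTime_capTime hσ t
  have h_stopped : Measurable[F t] fun ω => X (capTime (σ ω) t) ω :=
    (measurable_progressive_stopped hX hτ).mono
      (hτ.measurableSpace_le_of_le_const fun ω => WithTop.coe_le_coe.2 (capTime_le _ _)) le_rfl
  have h_pos : MeasurableSet[F t] {ω | ⊥ < σ ω} := F.mono bot_le _ (hσ.measurableSet_gt ⊥)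
  convert h_stopped.indicator h_pos using 1
  ext ω
  by_cases hω : ⊥ < σ ω
  · simp [hω, localized_of_bot_lt]
  · simp [hω, localized_of_not_bot_lt]

lemma isProgressive_compensated {κ : Ω → Measure (Time T)} [∀ ω, IsFiniteMeasure (κ ω)]
    (hκ : IsAdaptedMeasure F κ) (hM : IsProgressive F M) (hK : IsProgressive F K) :
    IsProgressive F (compensated κ M K) := fun t =>
  (hM t).sub (isProgressive_setIntegral_Iic hK hκ t)

lemma setIntegral_martingale_stopped (hN : Martingale N F P)
    (hNc : ∀ ω t, ContinuousWithinAt (fun v => N v ω) (Ici t) t) {τ : Ω → Time T}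
    (hτ : IsStoppingTime F fun ω => (τ ω : WithTop (Time T))) {B : Set Ω}
    (hB : MeasurableSet[F s] B) (hsτ : ∀ ω ∈ B, s ≤ τ ω) :
    ∫ ω in B, N (τ ω) ω - N s ω ∂P = 0 := by
  have hBτ := measurableSet_of_forall_le hτ hB hsτ
  rw [integral_sub (integral_martingale_stopped hN hNc hτ).1.integrableOn
      (hN.integrable s).integrableOn,
    setIntegral_congr_ae (hτ.measurableSpace_le _ hBτ)
      ((martingale_stopped_ae_eq_condExp hN hNc hτ).mono fun _ h _ => h),
    setIntegral_condExp hτ.measurableSpace_le (hN.integrable ⊤) hBτ,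
    hN.setIntegral_eq le_top hB, sub_self]

lemma setIntegral_mul_localized_sub_of_martingale (hq : Martingale q F P)
    (hc : ∀ ω t, ContinuousWithinAt (fun v => q v ω) (Ici t) t) (h0 : ∀ t ω, 0 ≤ q t ω)
    (hκ : IsAdaptedMeasure F κ) (hM : IsProgressive F M) (hK : IsProgressive F K)
    (hσ : IsStoppingTime F σ) (hσb : IsBoundedUpTo κ M K c σ)
    (hρN : Martingale (localized N ρ) F P)
    (hNc : ∀ ω t, ContinuousWithinAt (fun v => N v ω) (Ici t) t) (hσρ : σ ≤ ρ)
    (hNM : ∀ᵐ ω ∂P, Integrable (fun u => K u ω * q u ω) (κ ω) ∧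
      ∀ t, N t ω = q t ω * M t ω - ∫ u in Iic t, K u ω * q u ω ∂κ ω)
    (hst : s ≤ t) (hA : MeasurableSet[F s] A) :
    ∫ ω in A, q ⊤ ω *
      (localized (compensated κ M K) σ t ω - localized (compensated κ M K) σ s ω) ∂P = 0 := by
  set B : Set Ω := A ∩ {ω | (s : WithTop (Time T)) < σ ω}
  set τ : Ω → Time T := fun ω => capTime (σ ω) t
  have hB : MeasurableSet[F s] B := hA.inter (hσ.measurableSet_gt s)
  have hBm : MeasurableSet B := F.le s _ hB
  have hτ := isStoppingTime_capTime hσ t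
  have hsτ : ∀ ω ∈ B, s ≤ τ ω := fun ω hω => le_capTime_iff.2 ⟨hst, hω.2.le⟩
  have hpos : ∀ ω ∈ B, ⊥ < σ ω := fun ω hω => bot_le.trans_lt hω.2
  have hKm : ∀ ω, Measurable fun u => K u ω := fun ω =>
    (measurable_uncurry_of_isProgressive hK).comp measurable_prodMk_left
  have h_outside : ∀ ω ∈ A \ B, q ⊤ ω *
      (localized (compensated κ M K) σ t ω - localized (compensated κ M K) σ s ω) = 0 :=
    fun ω hω => by
      rw [localized_congr_of_le hst (not_lt.1 fun h => hω.2 ⟨hω.1, h⟩), sub_self, mul_zero]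
  calc ∫ ω in A, q ⊤ ω *
        (localized (compensated κ M K) σ t ω - localized (compensated κ M K) σ s ω) ∂P
      = ∫ ω in B, q ⊤ ω *
        (localized (compensated κ M K) σ t ω - localized (compensated κ M K) σ s ω) ∂P :=
        setIntegral_eq_of_subset_of_forall_sdiff_eq_zero (F.le s _ hA) inter_subset_left h_outside
    _ = ∫ ω in B, q ⊤ ω * (M (τ ω) ω - M s ω - ∫ u in Ioc s (τ ω), K u ω ∂κ ω) ∂P :=
        setIntegral_congr_fun hBm fun ω hω => by
          simp only [localized_compensated_sub_of_lt hσb (hKm ω) hst hω.2, τ]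
    _ = ∫ ω in B, q (τ ω) ω * M (τ ω) ω - q s ω * M s ω -
          ∫ u in Ioc s (τ ω), K u ω * q u ω ∂κ ω ∂P :=
        (setIntegral_increment_mul_martingale hq hc h0 hκ hK hM hB hτ hsτ
          (fun ω hω => (hσb ω (hpos ω hω) s hω.2.le).1)
          (fun ω hω => (hσb ω (hpos ω hω) _ (coe_capTime_le _ _)).1)
          fun ω hω => hσb.lintegral_Ioc_le (hpos ω hω) (coe_capTime_le _ _)).2.symm
    _ = ∫ ω in B, localized N ρ (τ ω) ω - localized N ρ s ω ∂P := by
        refine setIntegral_congr_ae hBm (hNM.mono fun ω hω hωB => ?_)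
        have hωρ : ⊥ < ρ ω := (hpos ω hωB).trans_le (hσρ ω)
        rw [localized_of_le hωρ ((coe_capTime_le _ _).trans (hσρ ω)),
          localized_of_le hωρ (hωB.2.le.trans (hσρ ω)), hω.2, hω.2,
          ← setIntegral_Iic_sub_setIntegral_Iic (hsτ ω hωB) hω.1.integrableOn]
        ring
    _ = 0 := setIntegral_martingale_stopped hρN
        (fun ω => continuousWithinAt_Ici_localized (hNc ω)) hτ hB hsτ

lemma eventually_eq_top_of_tendsto {τ : ℕ → WithTop (Time T)} (h : Tendsto τ atTop (𝓝 ⊤)) :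
    ∀ᶠ m in atTop, τ m = ⊤ := by
  filter_upwards [h.eventually (Ioi_mem_nhds (WithTop.coe_lt_top (⊤ : Time T)))] with m hm
  by_contra hne
  obtain ⟨u, hu⟩ := WithTop.ne_top_iff_exists.1 hne
  exact absurd (WithTop.coe_lt_coe.1 (hu ▸ hm)) (not_lt.2 le_top)

/-- Girsanov's theorem: the conclusion is the martingale property under the measure with density
`q ⊤` with respect to `P`. -/
theorem setIntegral_mul_localized_sub (hq : Martingale q F P)
    (hc : ∀ ω t, ContinuousWithinAt (fun v => q v ω) (Ici t) t) (h0 : ∀ t ω, 0 ≤ q t ω)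
    (hκ : IsAdaptedMeasure F κ) (hM : IsProgressive F M) (hK : IsProgressive F K)
    (hσ : IsStoppingTime F σ) (hσb : IsBoundedUpTo κ M K c σ) (hN : IsLocalMartingale F P N)
    (hNc : ∀ ω t, ContinuousWithinAt (fun v => N v ω) (Ici t) t)
    (hNM : ∀ᵐ ω ∂P, Integrable (fun u => K u ω * q u ω) (κ ω) ∧
      ∀ t, N t ω = q t ω * M t ω - ∫ u in Iic t, K u ω * q u ω ∂κ ω)
    (hst : s ≤ t) (hA : MeasurableSet[F s] A) :
    ∫ ω in A, q ⊤ ω *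
      (localized (compensated κ M K) σ t ω - localized (compensated κ M K) σ s ω) ∂P = 0 := by
  obtain ⟨ρ, hρ, hρN⟩ := hN.locally_martingale
  set f : ℕ → Ω → ℝ := fun m ω => q ⊤ ω *
    (localized (compensated κ M K) (fun ω => min (σ ω) (ρ m ω)) t ω -
      localized (compensated κ M K) (fun ω => min (σ ω) (ρ m ω)) s ω)
  have h_zero : ∀ m, ∫ ω in A, f m ω ∂P = 0 := fun m =>
    setIntegral_mul_localized_sub_of_martingale hq hc h0 hκ hM hK
      (hσ.min (hρ.isStoppingTime m)) (hσb.mono fun ω => min_le_left _ _) (hρN m) hNc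
      (fun ω => min_le_right _ _) hNM hst hA
  have h_tendsto : ∀ᵐ ω ∂P.restrict A, Tendsto (fun m => f m ω) atTop (𝓝 (q ⊤ ω *
      (localized (compensated κ M K) σ t ω - localized (compensated κ M K) σ s ω))) := by
    refine ae_restrict_of_ae (hρ.tendsto_top.mono fun ω hω => tendsto_const_nhds.congr' ?_)
    filter_upwards [eventually_eq_top_of_tendsto hω] with m hm
    have h_min : min (σ ω) (ρ m ω) = σ ω := by rw [hm, min_top_right]
    have h_congr : ∀ r, localized (compensated κ M K) (fun ω => min (σ ω) (ρ m ω)) r ω =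
        localized (compensated κ M K) σ r ω := fun r => localized_congr h_min
    simp only [f, h_congr]
  have h_norm : ∀ m r ω,
      ‖localized (compensated κ M K) (fun ω => min (σ ω) (ρ m ω)) r ω‖ ≤ 2 * c := fun m r ω =>
    norm_localized_compensated_le (hσb.mono fun ω => min_le_left _ _) r
  have h_bound : ∀ m, ∀ᵐ ω ∂P.restrict A, ‖f m ω‖ ≤ ‖q ⊤ ω‖ * (2 * c + 2 * c) := fun m =>
    ae_of_all _ fun ω => by
      rw [norm_mul]
      gcongr
      exact (norm_sub_le _ _).trans (add_le_add (h_norm m t ω) (h_norm m s ω))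
  have h_meas : ∀ m r, Measurable
      (localized (compensated κ M K) (fun ω => min (σ ω) (ρ m ω)) r) := fun m r =>
    (measurable_localized (isProgressive_compensated hκ hM hK)
      (hσ.min (hρ.isStoppingTime m)) r).mono (F.le r) le_rfl
  have hq_meas : Measurable (q ⊤) := (hq.stronglyMeasurable ⊤).measurable.mono (F.le ⊤) le_rfl
  have h_lim := tendsto_integral_of_dominated_convergence _
    (fun m => (hq_meas.mul ((h_meas m t).sub (h_meas m s))).aestronglyMeasurable)
    ((hq.integrable ⊤).norm.restrict.mul_const (2 * c + 2 * c : ℝ)) h_bound h_tendsto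
  exact tendsto_nhds_unique h_lim (tendsto_const_nhds.congr fun m => (h_zero m).symm)

end Girsanov

section HittingTime

variable {T : ℝ≥0} {Ω β : Type*} {V : Time T → Ω → β} {U : Set β}

lemma hittingAfter_bot_eq_top_time_iff {ω : Ω} :
    hittingAfter V U ⊥ ω = ((⊤ : Time T) : WithTop (Time T)) ↔
      V ⊤ ω ∈ U ∧ ¬ hittingAfter V U ⊥ ω < ((⊤ : Time T) : WithTop (Time T)) := by
  refine ⟨fun h => ⟨?_, h.not_lt⟩, fun h =>
    (hittingAfter_le_of_mem bot_le h.1).antisymm (not_lt.1 h.2)⟩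
  have h_ne : hittingAfter V U ⊥ ω ≠ ⊤ := h ▸ WithTop.coe_ne_top
  obtain ⟨j, -, hj⟩ : ∃ j, ⊥ ≤ j ∧ V j ω ∈ U := by
    simpa using mt hittingAfter_eq_top_iff.2 h_ne
  have h_le := hittingAfter_le_of_mem (bot_le (a := j)) hj
  rw [h, WithTop.coe_le_coe, top_le_iff] at h_le
  exact h_le ▸ hj

variable [TopologicalSpace β]

lemma exists_lt_mem_of_leftContinuous {f : Time T → β} {t : Time T} {D : Set (Time T)}
    (hf : ContinuousWithinAt f (Iic t) t) (hU : IsOpen U) (hD : Dense D) (ht : ⊥ < t)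
    (hft : f t ∈ U) : ∃ d ∈ D, d < t ∧ f d ∈ U := by
  obtain ⟨r, hrt, hr⟩ := (mem_nhdsLE_iff_exists_Ioc_subset' ht).1 (hf (hU.mem_nhds hft))
  obtain ⟨d, hdD, hd⟩ := hD.exists_between hrt
  exact ⟨d, hdD, hd.2, hr ⟨hd.1, hd.2.le⟩⟩

lemma hittingAfter_bot_lt_of_mem {t : Time T} {ω : Ω}
    (hV : ContinuousWithinAt (fun u => V u ω) (Iic t) t) (hU : IsOpen U) (ht : ⊥ < t)
    (h : V t ω ∈ U) : hittingAfter V U ⊥ ω < t := by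
  obtain ⟨d, -, hdt, hd⟩ := exists_lt_mem_of_leftContinuous hV hU dense_univ ht h
  exact hittingAfter_lt_iff.2 ⟨d, ⟨bot_le, hdt⟩, hd⟩

lemma setOf_hittingAfter_bot_lt_eq (hV : ∀ ω t, ContinuousWithinAt (fun u => V u ω) (Iic t) t)
    (hU : IsOpen U) {D : Set (Time T)} (hD : Dense D) (hD_bot : ⊥ ∈ D) (t : Time T) :
    {ω | hittingAfter V U ⊥ ω < t} = ⋃ d ∈ D ∩ Iio t, V d ⁻¹' U := by
  ext ω
  simp only [mem_iUnion₂, mem_inter_iff, mem_preimage]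
  refine hittingAfter_lt_iff.trans ⟨?_, fun ⟨d, hd, hVd⟩ => ⟨d, ⟨bot_le, hd.2⟩, hVd⟩⟩
  rintro ⟨j, hjt, hj⟩
  rcases eq_bot_or_bot_lt j with rfl | hj_pos
  · exact ⟨⊥, ⟨hD_bot, hjt.2⟩, hj⟩
  · obtain ⟨d, hdD, hdj, hd⟩ := exists_lt_mem_of_leftContinuous (hV ω j) hU hD hj_pos hj
    exact ⟨d, ⟨hdD, hdj.trans hjt.2⟩, hd⟩

theorem isStoppingTime_hittingAfter_of_leftContinuous {mΩ : MeasurableSpace Ω}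
    {F : Filtration (Time T) mΩ} [F.IsRightContinuous] [MeasurableSpace β]
    [OpensMeasurableSpace β] (hV : ∀ t, Measurable[F t] (V t))
    (hVc : ∀ ω t, ContinuousWithinAt (fun u => V u ω) (Iic t) t) (hU : IsOpen U) :
    IsStoppingTime F (hittingAfter V U ⊥) := by
  obtain ⟨D, hD_count, hD, hD_bot, -⟩ := exists_countable_dense_bot_top (Time T)
  have h_lt : ∀ t, MeasurableSet[F t] {ω | hittingAfter V U ⊥ ω < t} := fun t => by
    rw [setOf_hittingAfter_bot_lt_eq hVc hU hD (hD_bot ⊥ isBot_bot)]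
    exact MeasurableSet.biUnion (hD_count.mono inter_subset_left) fun d hd =>
      F.mono (le_of_lt hd.2) _ (hV d hU.measurableSet)
  refine isStoppingTime_of_measurableSet_lt_of_isRightContinuous' h_lt fun t ht => ?_
  obtain rfl : t = ⊤ := by
    by_contra h_ne
    exact (nhdsGT_neBot_of_exists_gt ⟨⊤, lt_top_iff_ne_top.2 h_ne⟩).ne ht
  simp only [hittingAfter_bot_eq_top_time_iff]
  exact (hV ⊤ hU.measurableSet).inter (h_lt ⊤).compl

end HittingTime

section ExitTime

variable {T : ℝ≥0}

lemma continuousWithinAt_measure_Iic {ν : Measure (Time T)} {t : Time T} (ht : ν {t} = 0) :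
    ContinuousWithinAt (fun u => ν (Iic u)) (Iic t) t := by
  rcases eq_bot_or_bot_lt t with rfl | ht_pos
  · rw [Iic_bot]
    exact continuousWithinAt_singleton
  obtain ⟨u, hu_mono, hu_mem, hu_tendsto⟩ := exists_seq_strictMono_tendsto' ht_pos
  have h_union : ⋃ n, Iic (u n) = Iio t := iUnion_Iic_eq_Iio_of_lt_of_tendsto
    (fun n => (hu_mem n).2) hu_tendsto
  have h_sup : ν (Iic t) = ⨆ n, ν (Iic (u n)) := by
    rw [← Monotone.measure_iUnion fun m n h => Iic_subset_Iic.2 (hu_mono.monotone h), h_union]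
    exact (measure_congr (Iio_ae_eq_Iic' ht)).symm
  refine tendsto_order.2 ⟨fun a ha => ?_, fun a ha => ?_⟩
  · obtain ⟨n, hn⟩ := lt_iSup_iff.1 (ha.trans_eq h_sup)
    filter_upwards [mem_nhdsWithin_of_mem_nhds (Ioi_mem_nhds (hu_mem n).2)] with v hv
    exact hn.trans_le (measure_mono (Iic_subset_Iic.2 (le_of_lt hv)))
  · filter_upwards [self_mem_nhdsWithin] with v hv
    exact (measure_mono (Iic_subset_Iic.2 hv)).trans_lt ha

variable {Ω : Type*} {κ : Ω → Measure (Time T)} {M K : Time T → Ω → ℝ} {ω : Ω}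

/-- The larger of `|M|` and the total variation of `∫ K dκ`. -/
def control (κ : Ω → Measure (Time T)) (M K : Time T → Ω → ℝ) (t : Time T) (ω : Ω) : ℝ≥0∞ :=
  max ‖M t ω‖ₑ (∫⁻ u in Iic t, ‖K u ω‖ₑ ∂κ ω)

/-- The first time at which `|M|` or the total variation of `∫ K dκ` exceeds `c`. -/
def exitTime (κ : Ω → Measure (Time T)) (M K : Time T → Ω → ℝ) (c : ℝ≥0) :
    Ω → WithTop (Time T) :=
  hittingAfter (control κ M K) (Ioi (c : ℝ≥0∞)) ⊥

lemma continuousWithinAt_Iic_control (hκ0 : ∀ t, κ ω {t} = 0) (hM : Continuous fun t => M t ω)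
    (t : Time T) : ContinuousWithinAt (fun u => control κ M K u ω) (Iic t) t := by
  have h_null : ((κ ω).withDensity fun u => ‖K u ω‖ₑ) {t} = 0 :=
    withDensity_absolutelyContinuous _ _ (hκ0 t)
  have h_int := continuousWithinAt_measure_Iic h_null
  simp only [withDensity_apply _ measurableSet_Iic] at h_int
  exact hM.enorm.continuousWithinAt.max h_int

lemma isStoppingTime_exitTime {mΩ : MeasurableSpace Ω} {F : Filtration (Time T) mΩ}
    [F.IsRightContinuous] [∀ ω, IsFiniteMeasure (κ ω)] (hκ : IsAdaptedMeasure F κ)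
    (hκ0 : ∀ ω t, κ ω {t} = 0) (hM : StronglyAdapted F M)
    (hMc : ∀ ω, Continuous fun t => M t ω) (hK : IsProgressive F K) (c : ℝ≥0) :
    IsStoppingTime F (exitTime κ M K c) :=
  isStoppingTime_hittingAfter_of_leftContinuous
    (fun t => Measurable.max (measurable_enorm.comp (hM t).measurable)
      ((isProgressive_setLIntegral_Iic (fun t => measurable_enorm.comp (hK t)) hκ).adapted t))
    (fun ω => continuousWithinAt_Iic_control (hκ0 ω) (hMc ω)) isOpen_Ioi

lemma isBoundedUpTo_exitTime (hκ0 : ∀ ω t, κ ω {t} = 0) (hM : ∀ ω, Continuous fun t => M t ω)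
    (c : ℝ≥0) : IsBoundedUpTo κ M K c (exitTime κ M K c) := by
  intro ω hω u hu
  have h_le : control κ M K u ω ≤ c := by
    by_contra! h_gt
    have h_hit : exitTime κ M K c ω ≤ u := hittingAfter_le_of_mem bot_le h_gt
    exact (hittingAfter_bot_lt_of_mem (continuousWithinAt_Iic_control (hκ0 ω) (hM ω) u) isOpen_Ioi
      (WithTop.coe_lt_coe.1 (hω.trans_le h_hit)) h_gt).not_ge hu
  obtain ⟨hM_le, hK_le⟩ := max_le_iff.1 h_le
  exact ⟨by rwa [← coe_nnnorm, NNReal.coe_le_coe, ← ENNReal.coe_le_coe], hK_le⟩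

lemma monotone_exitTime (ω : Ω) : Monotone fun c => exitTime κ M K c ω := fun _ _ h =>
  hittingAfter_apply_anti _ _ _ (Ioi_subset_Ioi (ENNReal.coe_le_coe.2 h))

lemma eventually_exitTime_eq_top (hM : Continuous fun t => M t ω)
    (hK : ∫⁻ u, ‖K u ω‖ₑ ∂κ ω < ∞) : ∀ᶠ n : ℕ in atTop, exitTime κ M K n ω = ⊤ := by
  obtain ⟨a, ha⟩ := ((isCompact_Icc (a := (⊥ : Time T)) (b := ⊤)).image hM.nnnorm).bddAbove
  obtain ⟨m, hm⟩ := exists_nat_ge (max a (∫⁻ u, ‖K u ω‖ₑ ∂κ ω).toNNReal)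
  filter_upwards [eventually_ge_atTop m] with n hn
  have h_le : max a (∫⁻ u, ‖K u ω‖ₑ ∂κ ω).toNNReal ≤ n := hm.trans (Nat.cast_le.2 hn)
  refine hittingAfter_eq_top_iff.2 fun t _ => notMem_Ioi.2 (max_le ?_ ?_)
  · exact ENNReal.coe_le_coe.2
      ((ha ⟨t, ⟨bot_le, le_top⟩, rfl⟩).trans ((le_max_left _ _).trans h_le))
  · exact (setLIntegral_le_lintegral _ _).trans ((ENNReal.coe_toNNReal hK.ne).symm.trans_le
      (ENNReal.coe_le_coe.2 ((le_max_right _ _).trans h_le)))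

end ExitTime

section Disintegration

variable {Ω E Ω' : Type*} {mΩ : MeasurableSpace Ω} {mE : MeasurableSpace E}
  {mΩ' : MeasurableSpace Ω'} {P : Measure Ω} [IsFiniteMeasure P] {X : Ω → E} {φ : Ω → Ω'}
  {g : E × Ω' → ℝ≥0∞}

lemma map_prodMk_eq_withDensity (hX : Measurable X) (hφ : Measurable φ) (hg : Measurable g)
    (h : ∀ A B, MeasurableSet A → MeasurableSet B →
      P (X ⁻¹' B ∩ φ ⁻¹' A) = ∫⁻ ω in φ ⁻¹' A, ∫⁻ x in B, g (x, φ ω) ∂(P.map X) ∂P) :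
    P.map (fun ω => (X ω, φ ω)) = ((P.map X).prod (P.map φ)).withDensity g := by
  refine Measure.ext_prod fun {B A} hB hA => ?_
  rw [Measure.map_apply (hX.prodMk hφ) (hB.prod hA), withDensity_apply _ (hB.prod hA),
    ← Measure.prod_restrict, lintegral_prod_symm _ hg.aemeasurable,
    setLIntegral_map hA hg.lintegral_prod_left' hφ, ← h A B hA hB]
  rfl

lemma integral_comp_eq_integral_integral_density {f : E × Ω' → ℝ} (hX : Measurable X)
    (hφ : Measurable φ) (hg : Measurable g) (hg_top : ∀ p, g p < ∞)
    (h_map : P.map (fun ω => (X ω, φ ω)) = ((P.map X).prod (P.map φ)).withDensity g)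
    (hf : Measurable f) (hf_int : Integrable (fun ω => f (X ω, φ ω)) P) :
    ∫ ω, f (X ω, φ ω) ∂P = ∫ x, ∫ ω, (g (x, φ ω)).toReal * f (x, φ ω) ∂P ∂(P.map X) := by
  have h_pair := (hX.prodMk hφ).aemeasurable (μ := P)
  have h_int : Integrable f (((P.map X).prod (P.map φ)).withDensity g) :=
    h_map ▸ (integrable_map_measure hf.aestronglyMeasurable h_pair).2 hf_int
  rw [integrable_withDensity_iff_integrable_smul' hg (ae_of_all _ hg_top)] at h_int
  rw [← integral_map h_pair hf.aestronglyMeasurable, h_map,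
    integral_withDensity_eq_integral_toReal_smul hg (ae_of_all _ hg_top), integral_prod _ h_int]
  exact integral_congr_ae (ae_of_all _ fun x => integral_map hφ.aemeasurable
    ((hg.ennreal_toReal.mul hf).comp measurable_prodMk_left).aestronglyMeasurable)

lemma ae_comp_of_density {S : Set (E × Ω')} (hX : Measurable X) (hφ : Measurable φ)
    (hg : Measurable g)
    (h_map : P.map (fun ω => (X ω, φ ω)) = ((P.map X).prod (P.map φ)).withDensity g)
    (hS : MeasurableSet S) (h : ∀ x, ∀ᵐ ω ∂P, 0 < g (x, φ ω) → (x, φ ω) ∈ S) :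
    ∀ᵐ ω ∂P, (X ω, φ ω) ∈ S := by
  rw [← ae_map_iff (p := (· ∈ S)) (hX.prodMk hφ).aemeasurable hS, h_map, ae_withDensity_iff hg]
  have hS' : MeasurableSet {p | g p ≠ 0 → p ∈ S} := (hg (measurableSet_singleton 0)).compl.imp hS
  refine (Measure.ae_prod_iff_ae_ae hS').2 (ae_of_all _ fun x => ?_)
  rw [ae_map_iff (p := fun y => g (x, y) ≠ 0 → (x, y) ∈ S) hφ.aemeasurable
    (measurable_prodMk_left hS')]
  exact (h x).mono fun ω hω h_ne => hω (pos_iff_ne_zero.2 h_ne)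

end Disintegration

lemma measure_inter_eq_lintegral_density {Ω : Type*} {m mΩ : MeasurableSpace Ω} {P : Measure Ω}
    [IsFiniteMeasure P] {L : Ω → ℝ} (hL : Measurable L) (hm : m ≤ mΩ)
    {Q : @Kernel Ω ℝ m inferInstance} (hQ : IsRegularCondLaw P L m Q) {g : ℝ → Ω → ℝ≥0∞}
    (hg : ∀ᵐ ω ∂P, Q ω = (P.map L).withDensity fun x => g x ω)
    {A : Set Ω} (hA : MeasurableSet[m] A) {B : Set ℝ} (hB : MeasurableSet B) :
    P (L ⁻¹' B ∩ A) = ∫⁻ ω in A, ∫⁻ x in B, g x ω ∂(P.map L) ∂P := by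
  have := hQ.isMarkovKernel
  have hLB : MeasurableSet (L ⁻¹' B) := hL hB
  have h_real : ∫ ω in A, (Q ω).real B ∂P = P.real (L ⁻¹' B ∩ A) := by
    rw [setIntegral_congr_ae (g := P[(L ⁻¹' B).indicator fun _ => (1 : ℝ) | m]) (hm _ hA)
        ((hQ.condExp_eq B hB).mono fun ω h _ => h),
      setIntegral_condExp hm ((integrable_const _).indicator hLB) hA,
      integral_indicator_const _ hLB, smul_eq_mul, mul_one, measureReal_restrict_apply hLB]
  have h_meas : Measurable fun ω => (Q ω).real B :=
    ((Kernel.measurable_coe Q hB).mono hm le_rfl).ennreal_toReal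
  have h_int : IntegrableOn (fun ω => (Q ω).real B) A P :=
    Integrable.of_bound h_meas.aestronglyMeasurable 1 (ae_of_all _ fun ω => by
      rw [Real.norm_of_nonneg measureReal_nonneg]
      exact measureReal_le_one)
  calc P (L ⁻¹' B ∩ A) = ENNReal.ofReal (∫ ω in A, (Q ω).real B ∂P) := by
        rw [h_real, ofReal_measureReal]
    _ = ∫⁻ ω in A, Q ω B ∂P := by
        rw [ofReal_integral_eq_lintegral_ofReal h_int (ae_of_all _ fun ω => measureReal_nonneg)]
        exact lintegral_congr fun ω => ofReal_measureReal
    _ = ∫⁻ ω in A, ∫⁻ x in B, g x ω ∂(P.map L) ∂P :=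
        lintegral_congr_ae (ae_restrict_of_ae (hg.mono fun ω hω => by
          simp only [hω, withDensity_apply _ hB]))

section IndefiniteIntegral

variable {β : Type*} [LinearOrder β] [TopologicalSpace β] [OrderTopology β] [MeasurableSpace β]
  [OpensMeasurableSpace β] {ν : Measure β} {f : β → ℝ}

lemma continuous_setIntegral_Iic [FirstCountableTopology β] (hν : ∀ t, ν {t} = 0)
    (hf : Integrable f ν) : Continuous fun t => ∫ u in Iic t, f u ∂ν := by
  simp_rw [← integral_indicator (measurableSet_Iic : MeasurableSet (Iic (_ : β)))]
  refine continuous_iff_continuousAt.2 fun t => continuousAt_of_dominated (bound := fun u => ‖f u‖)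
    (Eventually.of_forall fun v => (hf.indicator measurableSet_Iic).aestronglyMeasurable)
    (Eventually.of_forall fun v => ae_of_all _ fun u => norm_indicator_le_norm_self _ _) hf.norm ?_
  have h_ne : ∀ᵐ u ∂ν, u ≠ t := measure_eq_zero_iff_ae_notMem.1 (hν t)
  filter_upwards [h_ne] with u hu
  rcases lt_or_gt_of_ne hu with h | h
  · refine (continuousAt_const (y := f u)).congr ?_
    filter_upwards [lt_mem_nhds h] with v hv
    exact (indicator_of_mem (mem_Iic.2 hv.le) f).symm
  · refine (continuousAt_const (y := (0 : ℝ))).congr ?_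
    filter_upwards [gt_mem_nhds h] with v hv
    exact (indicator_of_notMem (notMem_Iic.2 hv) f).symm

lemma boundedVariationOn_setIntegral_Iic [BoundedOrder β] (hf : Integrable f ν) :
    BoundedVariationOn (fun t => ∫ u in Iic t, f u ∂ν) univ := by
  set V : β → ℝ := fun t => ∫ u in Iic t, ‖f u‖ ∂ν
  have hV : Monotone V := fun s t hst => setIntegral_mono_set hf.norm.integrableOn
    (ae_of_all _ fun _ => norm_nonneg _) (Iic_subset_Iic.2 hst).eventuallyLE
  have h_edist : ∀ s t, s ≤ t →
      edist (∫ u in Iic t, f u ∂ν) (∫ u in Iic s, f u ∂ν) ≤ edist (V t) (V s) := fun s t hst => by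
    rw [edist_dist, edist_dist, dist_eq_norm, dist_eq_norm,
      setIntegral_Iic_sub_setIntegral_Iic hst hf.integrableOn,
      setIntegral_Iic_sub_setIntegral_Iic hst hf.norm.integrableOn]
    exact ENNReal.ofReal_le_ofReal ((norm_integral_le_integral_norm _).trans (le_abs_self _))
  have hV_top : eVariationOn V univ ≠ ∞ := by
    have h_eq := (hV.monotoneOn univ).eVariationOn_eq (mem_univ ⊥) (mem_univ ⊤)
    rw [Icc_bot_top, inter_univ] at h_eq
    rw [h_eq]
    exact ENNReal.ofReal_ne_top
  exact ne_top_of_le_ne_top hV_top (iSup_le fun p => (Finset.sum_le_sum fun i _ =>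
    h_edist _ _ (p.2.2.1 i.le_succ)).trans (eVariationOn.sum_le p.2.2.1 fun i => p.2.2.2 i))

end IndefiniteIntegral

lemma continuous_localized_compensated {T : ℝ≥0} {Ω : Type*} {κ : Ω → Measure (Time T)}
    {M K : Time T → Ω → ℝ} {c : ℝ≥0} {σ : Ω → WithTop (Time T)} {ω : Ω}
    (hκ0 : ∀ t, κ ω {t} = 0) (hM : Continuous fun t => M t ω) (hK : Measurable fun u => K u ω)
    (hσ : IsBoundedUpTo κ M K c σ) :
    Continuous fun t => localized (compensated κ M K) σ t ω := by
  by_cases hω : ⊥ < σ ω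
  · set b : Time T := capTime (σ ω) ⊤
    have h_int : IntegrableOn (fun u => K u ω) (Iic b) (κ ω) := ⟨hK.aestronglyMeasurable,
      (hσ ω hω b (coe_capTime_le _ _)).2.trans_lt ENNReal.coe_lt_top⟩
    have h_cont := continuous_setIntegral_Iic
      (fun t => Measure.absolutelyContinuous_of_le Measure.restrict_le_self (hκ0 t)) h_int
    have h_restrict : ∀ t, ((κ ω).restrict (Iic b)).restrict (Iic (capTime (σ ω) t)) =
        (κ ω).restrict (Iic (capTime (σ ω) t)) := fun t =>
      Measure.restrict_restrict_of_subset (Iic_subset_Iic.2 (monotone_capTime _ le_top))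
    simp only [localized_of_bot_lt hω, compensated, ← h_restrict]
    exact (hM.comp (continuous_capTime _)).sub (h_cont.comp (continuous_capTime _))
  · simp only [localized_of_not_bot_lt hω, continuous_const]

section ChangeOfSpace

variable {T : ℝ≥0} {Ω Ω' : Type*} {mΩ : MeasurableSpace Ω} {mΩ' : MeasurableSpace Ω'}
  {F : Filtration (Time T) mΩ} {F' : Filtration (Time T) mΩ'} {φ : Ω → Ω'}

lemma isProgressive_comp {β : Type*} [MeasurableSpace β] {f : Time T → Ω' → β}
    (hf : IsProgressive F' f) (hφ : ∀ t, Measurable[F t, F' t] φ) :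
    IsProgressive F fun t ω => f t (φ ω) := fun t => by
  have h_map : Measurable[Subtype.instMeasurableSpace.prod (F t),
      Subtype.instMeasurableSpace.prod (F' t)] fun p : Iic t × Ω => (p.1, φ p.2) :=
    Measurable.prodMk (@measurable_fst _ _ _ (F t)) ((hφ t).comp (@measurable_snd _ _ _ (F t)))
  exact (hf t).comp h_map

lemma IsAdaptedMeasure.comp {κ : Ω' → Measure (Time T)} (hκ : IsAdaptedMeasure F' κ)
    (hφ : ∀ t, Measurable[F t, F' t] φ) : IsAdaptedMeasure F fun ω => κ (φ ω) := fun t =>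
  (hκ t).comp (hφ t)

end ChangeOfSpace

section Parametrized

variable {T : ℝ≥0} {Ω : Type*} {mΩ : MeasurableSpace Ω}

/-- The filtration `B(ℝ) ⊗ F t` on `ℝ × Ω`, for processes depending on a real parameter. -/
def parametrized (F : Filtration (Time T) mΩ) :
    Filtration (Time T) (inferInstance : MeasurableSpace (ℝ × Ω)) where
  seq t := MeasurableSpace.prod inferInstance (F t)
  mono' _ _ h := measurableSpace_prod_mono le_rfl (F.mono h)
  le' t := measurableSpace_prod_mono le_rfl (F.le t)

variable {F : Filtration (Time T) mΩ} {L : Ω → ℝ} {t : Time T}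

lemma measurable_snd_parametrized : Measurable[parametrized F t, F t] (Prod.snd : ℝ × Ω → Ω) :=
  @measurable_snd _ _ _ (F t)

lemma measurable_prodMk_left_parametrized (x : ℝ) :
    Measurable[F t, parametrized F t] (Prod.mk x : Ω → ℝ × Ω) :=
  @measurable_prodMk_left _ _ _ (F t) x

lemma comap_prodMk_parametrized (F : Filtration (Time T) mΩ) (L : Ω → ℝ) (t : Time T) :
    MeasurableSpace.comap (fun ω => (L ω, ω)) (parametrized F t) =
      F t ⊔ MeasurableSpace.comap L inferInstance := by
  have h := MeasurableSpace.comap_prodMk (mβ := (inferInstance : MeasurableSpace ℝ)) (mγ := F t)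
    L (id : Ω → Ω)
  rw [MeasurableSpace.comap_id] at h
  exact h.trans (sup_comm _ _)

lemma rightCont_top (F : Filtration (Time T) mΩ) : F.rightCont ⊤ = F ⊤ :=
  Filtration.rightCont_eq_of_isMax _ isMax_top

lemma measurableSet_rightCont_iff {F : Filtration (Time T) mΩ} (ht : t < ⊤) {A : Set Ω} :
    MeasurableSet[F.rightCont t] A ↔ ∀ r > t, MeasurableSet[F r] A := by
  rw [Filtration.rightCont_eq_of_not_isMax _ (not_isMax_iff.2 ⟨⊤, ht⟩)]
  simp only [MeasurableSpace.measurableSet_iInf]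

lemma measurable_rightCont {Ω' : Type*} {mΩ' : MeasurableSpace Ω'} {F' : Filtration (Time T) mΩ'}
    {φ : Ω → Ω'} (hφ : ∀ t, Measurable[F t, F' t] φ) (t : Time T) :
    Measurable[F.rightCont t, F'.rightCont t] φ := by
  rcases eq_or_lt_of_le (le_top (a := t)) with rfl | ht
  · rw [rightCont_top, rightCont_top]
    exact hφ ⊤
  · exact fun S hS => (measurableSet_rightCont_iff ht).2 fun r hr =>
      hφ r ((measurableSet_rightCont_iff ht).1 hS r hr)

lemma measurable_prodMk_enlargement (hL : Measurable L) (t : Time T) :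
    Measurable[enlargement F L hL t, (parametrized F).rightCont t] fun ω => (L ω, ω) :=
  measurable_rightCont (fun s => measurable_iff_comap_le.2 (comap_prodMk_parametrized F L s).le) t

lemma le_enlargement (hL : Measurable L) : F ≤ enlargement F L hL :=
  le_sup_left.trans (Filtration.le_rightCont _)

lemma IsJointlyProgressive.isProgressive {k : ℝ → Time T → Ω → ℝ}
    (hk : IsJointlyProgressive F k) : IsProgressive (parametrized F) fun t p => k p.1 t p.2 := by
  intro t
  let m : MeasurableSpace (Iic t × ℝ × Ω) := Subtype.instMeasurableSpace.prod (parametrized F t)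
  have h_time : Measurable[m] fun p : Iic t × ℝ × Ω => p.1 :=
    @measurable_fst _ _ _ (parametrized F t)
  have h_pair : Measurable[m, parametrized F t] fun p : Iic t × ℝ × Ω => p.2 :=
    @measurable_snd _ _ _ (parametrized F t)
  have h_param : Measurable[m] fun p : Iic t × ℝ × Ω => p.2.1 :=
    (@measurable_fst _ _ _ (F t)).comp h_pair
  have h_prod : Measurable[m, Subtype.instMeasurableSpace.prod (F t)]
      fun p : Iic t × ℝ × Ω => (p.1, p.2.2) :=
    Measurable.prodMk h_time (measurable_snd_parametrized.comp h_pair)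
  exact (hk t).comp (Measurable.prodMk h_prod h_param)

end Parametrized

section Substitution

variable {T : ℝ≥0} {Ω : Type*} {mΩ : MeasurableSpace Ω} {F : Filtration (Time T) mΩ}
  {P : Measure Ω} [IsFiniteMeasure P] {L : Ω → ℝ}
  {Q : ∀ t : Time T, @Kernel Ω ℝ (F t) inferInstance} {q : ℝ → Time T → Ω → ℝ}

lemma map_prodMk_eq_withDensity_conditionalDensity (hL : Measurable L)
    (hQ : IsRegularCondLaw P L (F ⊤) (Q ⊤)) (hq : IsConditionalDensity P F L Q q) :
    @Measure.map _ _ mΩ (parametrized F ⊤) (fun ω => (L ω, ω)) P =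
      @Measure.withDensity _ (parametrized F ⊤)
        (@Measure.prod _ _ _ (F ⊤) (P.map L) (@Measure.map _ _ mΩ (F ⊤) id P))
        fun p => ENNReal.ofReal (q p.1 ⊤ p.2) :=
  map_prodMk_eq_withDensity (mΩ' := F ⊤) (φ := id) hL (measurable_id'' (F.le ⊤))
    (ENNReal.measurable_ofReal.comp (hq.measurable ⊤)) fun _ _ hA hB =>
      measure_inter_eq_lintegral_density hL (F.le ⊤) hQ (hq.density ⊤) hA hB

lemma integral_comp_prodMk_eq_zero (hL : Measurable L) (hQ : IsRegularCondLaw P L (F ⊤) (Q ⊤))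
    (hq : IsConditionalDensity P F L Q q) {f : ℝ × Ω → ℝ} (hf : Measurable[parametrized F ⊤] f)
    (hf_int : Integrable (fun ω => f (L ω, ω)) P)
    (h : ∀ x, ∫ ω, q x ⊤ ω * f (x, ω) ∂P = 0) : ∫ ω, f (L ω, ω) ∂P = 0 := by
  have h_eq := integral_comp_eq_integral_integral_density (mΩ' := F ⊤) (φ := id) hL
    (measurable_id'' (F.le ⊤)) (ENNReal.measurable_ofReal.comp (hq.measurable ⊤))
    (fun _ => ENNReal.ofReal_lt_top) (map_prodMk_eq_withDensity_conditionalDensity hL hQ hq)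
    hf hf_int
  simp only [Function.comp_apply, id_eq, ENNReal.toReal_ofReal (hq.nonneg _ _ _), h,
    integral_zero] at h_eq
  exact h_eq

lemma ae_comp_prodMk (hL : Measurable L) (hQ : IsRegularCondLaw P L (F ⊤) (Q ⊤))
    (hq : IsConditionalDensity P F L Q q) {S : Set (ℝ × Ω)} (hS : MeasurableSet[parametrized F ⊤] S)
    (h : ∀ x, ∀ᵐ ω ∂P, 0 < q x ⊤ ω → (x, ω) ∈ S) : ∀ᵐ ω ∂P, (L ω, ω) ∈ S :=
  ae_comp_of_density (mΩ' := F ⊤) (φ := id) hL (measurable_id'' (F.le ⊤))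
    (ENNReal.measurable_ofReal.comp (hq.measurable ⊤))
    (map_prodMk_eq_withDensity_conditionalDensity hL hQ hq) hS
    fun x => (h x).mono fun _ hω hpos => hω (ENNReal.ofReal_pos.1 hpos)

lemma martingale_rightCont {F : Filtration (Time T) mΩ} {X : Time T → Ω → ℝ} {c : ℝ}
    (hX : StronglyAdapted F.rightCont X) (hXb : ∀ t ω, ‖X t ω‖ ≤ c)
    (hXc : ∀ ω t, ContinuousWithinAt (fun u => X u ω) (Ici t) t)
    (h : ∀ s t, s ≤ t → ∀ A, MeasurableSet[F s] A → ∫ ω in A, X t ω - X s ω ∂P = 0) :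
    Martingale X F.rightCont P := by
  have h_int : ∀ t, Integrable (X t) P := fun t =>
    Integrable.of_bound ((hX t).mono (F.rightCont.le t)).aestronglyMeasurable c
      (ae_of_all _ (hXb t))
  refine ⟨hX, fun s t hst => (ae_eq_condExp_of_forall_setIntegral_eq (F.rightCont.le s) (h_int t)
    (fun A _ _ => (h_int s).integrableOn) (fun A hA _ => ?_)
    (hX s).aestronglyMeasurable).symm⟩
  rcases eq_or_lt_of_le hst with rfl | hlt
  · rfl
  obtain ⟨r, -, hr_mem, hr⟩ := exists_seq_strictAnti_tendsto' hlt
  have h_eq : ∀ j, ∫ ω in A, X t ω ∂P = ∫ ω in A, X (r j) ω ∂P := fun j => by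
    have hA_r := (measurableSet_rightCont_iff (hlt.trans_le le_top)).1 hA (r j) (hr_mem j).1
    rw [← sub_eq_zero, ← integral_sub (h_int t).integrableOn (h_int (r j)).integrableOn]
    exact h _ _ (hr_mem j).2.le A hA_r
  have hr_within : Tendsto r atTop (𝓝[≥] s) := tendsto_nhdsWithin_iff.2
    ⟨hr, Eventually.of_forall fun j => (hr_mem j).1.le⟩
  have h_lim : Tendsto (fun j => ∫ ω in A, X (r j) ω ∂P) atTop (𝓝 (∫ ω in A, X s ω ∂P)) :=
    tendsto_integral_of_dominated_convergence (fun _ => c)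
      (fun j => (h_int (r j)).integrableOn.aestronglyMeasurable) (integrable_const _)
      (fun j => ae_of_all _ (hXb (r j))) (ae_of_all _ fun ω => (hXc ω s).tendsto.comp hr_within)
  exact tendsto_nhds_unique h_lim (tendsto_const_nhds.congr h_eq)

theorem martingale_enlargement_of_density (hL : Measurable L)
    (hQ : IsRegularCondLaw P L (F ⊤) (Q ⊤)) (hq : IsConditionalDensity P F L Q q)
    {X : Time T → ℝ × Ω → ℝ} {c : ℝ} (hX : ∀ t, Measurable[(parametrized F).rightCont t] (X t))
    (hXb : ∀ t p, ‖X t p‖ ≤ c) (hXc : ∀ p t, ContinuousWithinAt (fun u => X u p) (Ici t) t)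
    (h : ∀ x s t, s ≤ t → ∀ A, MeasurableSet[F s] A →
      ∫ ω in A, q x ⊤ ω * (X t (x, ω) - X s (x, ω)) ∂P = 0) :
    Martingale (fun t ω => X t (L ω, ω)) (enlargement F L hL) P := by
  have h_pair : ∀ t, Measurable[enlargement F L hL t, (parametrized F).rightCont t]
      fun ω => (L ω, ω) := measurable_prodMk_enlargement hL
  have hX_top : ∀ t, Measurable[parametrized F ⊤] (X t) := fun t =>
    (hX t).mono (((parametrized F).rightCont.mono le_top).trans_eq (rightCont_top _)) le_rfl
  have h_adapted : StronglyAdapted (enlargement F L hL) fun t ω => X t (L ω, ω) := fun t =>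
    ((hX t).comp (h_pair t)).stronglyMeasurable
  refine martingale_rightCont h_adapted (fun t ω => hXb t _) (fun ω => hXc _) ?_
  intro s t hst A hA
  have hA' : MeasurableSet[MeasurableSpace.comap (fun ω => (L ω, ω)) (parametrized F s)] A :=
    (comap_prodMk_parametrized F L s).symm ▸ hA
  obtain ⟨S, hS, rfl⟩ := hA'
  have hS' : MeasurableSet ((fun ω => (L ω, ω)) ⁻¹' S) :=
    (hL.prodMk measurable_id) ((parametrized F).le s _ hS)
  have h_int : ∀ r, Integrable (fun ω => X r (L ω, ω)) P := fun r =>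
    Integrable.of_bound ((h_adapted r).mono ((enlargement F L hL).le r)).aestronglyMeasurable c
      (ae_of_all _ fun ω => hXb r _)
  rw [← integral_indicator hS']
  refine integral_comp_prodMk_eq_zero (f := S.indicator fun p => X t p - X s p) hL hQ hq
    (((hX_top t).sub (hX_top s)).indicator ((parametrized F).mono le_top _ hS))
    (((h_int t).sub (h_int s)).indicator hS') fun x => ?_
  have hSx : MeasurableSet[F s] (Prod.mk x ⁻¹' S) := measurable_prodMk_left_parametrized x hS
  rw [← h x s t hst _ hSx, ← integral_indicator (F.le s _ hSx)]
  exact integral_congr_ae (ae_of_all _ fun ω =>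
    (indicator_mul_right (Prod.mk x ⁻¹' S) (q x ⊤) fun ω => X t (x, ω) - X s (x, ω)).symm)

end Substitution

section NullSets

variable {T : ℝ≥0} {Ω : Type*} {m mΩ : MeasurableSpace Ω} {P : Measure Ω}
  {F : Filtration (Time T) mΩ} {X Y : Time T → Ω → ℝ}

lemma measurable_of_ae_eq_of_complete {β : Type*} [MeasurableSpace β]
    (hm : ∀ S, P S = 0 → MeasurableSet[m] S) {f g : Ω → β} (hf : Measurable[m] f)
    (hfg : f =ᵐ[P] g) : Measurable[m] g := by
  intro B hB
  have h_eq : MeasurableSet[m] {ω | f ω = g ω} := (hm _ hfg).of_compl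
  have h_inter : g ⁻¹' B ∩ {ω | f ω = g ω} = f ⁻¹' B ∩ {ω | f ω = g ω} := by
    ext ω
    exact and_congr_left fun hω : f ω = g ω => by rw [mem_preimage, mem_preimage, hω]
  rw [← inter_union_compl (g ⁻¹' B) {ω | f ω = g ω}, h_inter]
  exact ((hf hB).inter h_eq).union (hm _ (measure_mono_null inter_subset_right hfg))

lemma stronglyAdapted_of_ae_eq (hF : ∀ S, P S = 0 → MeasurableSet[F ⊥] S)
    (hX : StronglyAdapted F X) (hXY : ∀ t, X t =ᵐ[P] Y t) : StronglyAdapted F Y := fun t =>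
  (measurable_of_ae_eq_of_complete (fun S hS => F.mono bot_le S (hF S hS)) (hX t).measurable
    (hXY t)).stronglyMeasurable

lemma martingale_of_ae_eq (hF : ∀ S, P S = 0 → MeasurableSet[F ⊥] S) (hX : Martingale X F P)
    (hXY : ∀ t, X t =ᵐ[P] Y t) : Martingale Y F P :=
  ⟨stronglyAdapted_of_ae_eq hF hX.1 hXY,
    fun s t hst => (condExp_congr_ae (hXY t).symm).trans ((hX.2 s t hst).trans (hXY s))⟩

lemma IsLocalMartingale.congr_ae (hF : ∀ S, P S = 0 → MeasurableSet[F ⊥] S)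
    (hX : IsLocalMartingale F P X) (hXY : ∀ᵐ ω ∂P, ∀ t, X t ω = Y t ω) :
    IsLocalMartingale F P Y := by
  obtain ⟨τ, hτ, hXτ⟩ := hX.locally_martingale
  refine ⟨stronglyAdapted_of_ae_eq hF hX.adapted fun t => hXY.mono fun ω hω => hω t, ?_, τ, hτ,
    fun n => martingale_of_ae_eq hF (hXτ n) fun t => ?_⟩
  · filter_upwards [hX.cadlag, hXY] with ω h_cadlag hω
    simpa only [hω] using h_cadlag
  · filter_upwards [hXY] with ω hω
    by_cases h : ⊥ < τ n ω
    · exact (localized_of_bot_lt h t).trans ((hω _).trans (localized_of_bot_lt h t).symm)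
    · exact (localized_of_not_bot_lt h t).trans (localized_of_not_bot_lt h t).symm

lemma exists_adapted_modification (hF : ∀ S, P S = 0 → MeasurableSet[F ⊥] S)
    {p : (Time T → ℝ) → Prop} (hp : p fun _ => 0) (hX : StronglyAdapted F X)
    (hpX : ∀ᵐ ω ∂P, p fun t => X t ω) :
    ∃ Y, StronglyAdapted F Y ∧ (∀ ω, p fun t => Y t ω) ∧ ∀ᵐ ω ∂P, ∀ t, X t ω = Y t ω := by
  classical
  set G : Set Ω := {ω | p fun t => X t ω}
  have hG : MeasurableSet[F ⊥] G := (hF _ hpX).of_compl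
  refine ⟨fun t => G.indicator (X t), fun t => (hX t).indicator (F.mono bot_le _ hG),
    fun ω => ?_, hpX.mono fun ω hω t => (indicator_of_mem (s := G) hω _).symm⟩
  by_cases hω : p fun t => X t ω
  · simpa only [indicator_of_mem (s := G) hω] using hω
  · simpa only [indicator_of_notMem (s := G) hω] using hp

end NullSets

section StoppedCompensated

variable {T : ℝ≥0} {Ω : Type*} {κ : Ω → Measure (Time T)} {M K : Time T → Ω → ℝ} {c : ℝ≥0}

/-- The process `M - ∫ K dκ`, localized at the first time at which `|M|` or the total variation of
`∫ K dκ` exceeds `c`. -/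
def stoppedCompensated (κ : Ω → Measure (Time T)) (M K : Time T → Ω → ℝ) (c : ℝ≥0) :
    Time T → Ω → ℝ :=
  localized (compensated κ M K) (exitTime κ M K c)

lemma norm_stoppedCompensated_le (hκ0 : ∀ ω t, κ ω {t} = 0)
    (hM : ∀ ω, Continuous fun t => M t ω) (t : Time T) (ω : Ω) :
    ‖stoppedCompensated κ M K c t ω‖ ≤ 2 * c :=
  norm_localized_compensated_le (isBoundedUpTo_exitTime hκ0 hM c) t

lemma continuous_stoppedCompensated (hκ0 : ∀ ω t, κ ω {t} = 0)
    (hM : ∀ ω, Continuous fun t => M t ω) {ω : Ω} (hK : Measurable fun u => K u ω) :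
    Continuous fun t => stoppedCompensated κ M K c t ω :=
  continuous_localized_compensated (hκ0 ω) (hM ω) hK (isBoundedUpTo_exitTime hκ0 hM c)

variable {mΩ : MeasurableSpace Ω} {F : Filtration (Time T) mΩ}

lemma isProgressive_of_continuous (hM : StronglyAdapted F M)
    (hMc : ∀ ω, Continuous fun t => M t ω) : IsProgressive F M :=
  isProgressive_of_rightContinuous (fun t => (hM t).measurable)
    fun ω _ => (hMc ω).continuousWithinAt

variable [F.IsRightContinuous] [∀ ω, IsFiniteMeasure (κ ω)]

lemma measurable_stoppedCompensated (hκ : IsAdaptedMeasure F κ) (hκ0 : ∀ ω t, κ ω {t} = 0)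
    (hM : StronglyAdapted F M) (hMc : ∀ ω, Continuous fun t => M t ω) (hK : IsProgressive F K)
    (t : Time T) : Measurable[F t] (stoppedCompensated κ M K c t) :=
  measurable_localized (isProgressive_compensated hκ (isProgressive_of_continuous hM hMc) hK)
    (isStoppingTime_exitTime hκ hκ0 hM hMc hK c) t

lemma isLocalMartingale_compensated {P : Measure Ω} (hκ : IsAdaptedMeasure F κ)
    (hκ0 : ∀ ω t, κ ω {t} = 0) (hM : StronglyAdapted F M) (hMc : ∀ ω, Continuous fun t => M t ω)
    (hK : IsProgressive F K) (hfin : ∀ᵐ ω ∂P, ∫⁻ u, ‖K u ω‖ₑ ∂κ ω < ∞)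
    (h : ∀ n : ℕ, Martingale (stoppedCompensated κ M K n) F P) :
    IsLocalMartingale F P (compensated κ M K) where
  adapted t := ((isProgressive_compensated hκ (isProgressive_of_continuous hM hMc)
    hK).adapted t).stronglyMeasurable
  cadlag := hfin.mono fun ω hω t => by
    have hK_meas : Measurable fun u => K u ω :=
      (measurable_uncurry_of_isProgressive hK).comp measurable_prodMk_left
    have h_cont : Continuous fun t => compensated κ M K t ω :=
      (hMc ω).sub (continuous_setIntegral_Iic (hκ0 ω) ⟨hK_meas.aestronglyMeasurable, hω⟩)
    exact ⟨h_cont.continuousWithinAt, _, h_cont.continuousWithinAt⟩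
  locally_martingale := ⟨fun n => exitTime κ M K n,
    ⟨⟨fun n => isStoppingTime_exitTime hκ hκ0 hM hMc hK n,
      hfin.mono fun ω hω => tendsto_const_nhds.congr'
        ((eventually_exitTime_eq_top (hMc ω) hω).mono fun n hn => hn.symm)⟩,
      ae_of_all _ fun ω _ _ hmn => monotone_exitTime ω (Nat.cast_le.2 hmn)⟩, h⟩

end StoppedCompensated

section Enlargement

variable {T : ℝ≥0} {Ω : Type*} {mΩ : MeasurableSpace Ω} {F : Filtration (Time T) mΩ}
  {P : Measure Ω} {L : Ω → ℝ} {Q : ∀ t : Time T, @Kernel Ω ℝ (F t) inferInstance}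
  {q : ℝ → Time T → Ω → ℝ} {κ : Ω → Measure (Time T)} [∀ ω, IsFiniteMeasure (κ ω)]
  {M : Time T → Ω → ℝ} {k : ℝ → Time T → Ω → ℝ}

lemma isProgressive_section (hk : IsJointlyProgressive F k) (x : ℝ) : IsProgressive F (k x) :=
  isProgressive_comp (φ := Prod.mk x) hk.isProgressive fun _ =>
    measurable_prodMk_left_parametrized x

lemma isProgressive_enlargement (hL : Measurable L) (hk : IsJointlyProgressive F k) :
    IsProgressive (enlargement F L hL) fun t ω => k (L ω) t ω :=
  isProgressive_comp (isProgressive_mono (Filtration.le_rightCont _) hk.isProgressive)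
    (measurable_prodMk_enlargement hL)

variable [IsFiniteMeasure P]

lemma ae_lintegral_substituted_lt_top (hL : Measurable L) (hQ : IsRegularCondLaw P L (F ⊤) (Q ⊤))
    (hq : IsConditionalDensity P F L Q q) (hκ : IsAdaptedMeasure F κ)
    (hk : IsJointlyProgressive F k)
    (h_int : ∀ x, ∀ᵐ ω ∂P, Integrable (fun u => k x u ω * q x u ω) (κ ω)) :
    ∀ᵐ ω ∂P, ∫⁻ u, ‖k (L ω) u ω‖ₑ ∂κ ω < ∞ := by
  let κ' : Kernel Ω (Time T) := ⟨κ, hκ.measurable⟩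
  have : ∀ ω, IsFiniteMeasure (κ' ω) := fun ω => inferInstanceAs (IsFiniteMeasure (κ ω))
  have h_meas : Measurable[parametrized F ⊤]
      fun p : ℝ × Ω => ∫⁻ u in Iic ⊤, ‖k p.1 u p.2‖ₑ ∂κ p.2 :=
    (isProgressive_setLIntegral_Iic (fun t => measurable_enorm.comp (hk.isProgressive t))
      (hκ.comp fun _ => measurable_snd_parametrized)).adapted ⊤
  simp only [Iic_top, Measure.restrict_univ] at h_meas
  refine ae_comp_prodMk (S := {p | ∫⁻ u, ‖k p.1 u p.2‖ₑ ∂κ p.2 < ∞}) hL hQ hq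
    (h_meas measurableSet_Iio) fun x => ?_
  refine lintegral_lt_top_of_martingale_pos (κ := κ') (hq.martingale x)
    (fun ω u => (hq.cadlag x ω u).1) (hq.nonneg x) hκ
    (fun t => measurable_enorm.comp (isProgressive_section hk x t)) ?_
  filter_upwards [h_int x] with ω hω
  refine (lintegral_congr fun u => ?_).trans_lt hω.2
  rw [enorm_mul, Real.enorm_of_nonneg (hq.nonneg x u ω)]

lemma martingale_stoppedCompensated_enlargement [F.IsRightContinuous] (hL : Measurable L)
    (hQ : IsRegularCondLaw P L (F ⊤) (Q ⊤)) (hq : IsConditionalDensity P F L Q q)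
    (hκ : IsAdaptedMeasure F κ) (hκ0 : ∀ ω t, κ ω {t} = 0) (hM : StronglyAdapted F M)
    (hMc : ∀ ω, Continuous fun t => M t ω) (hk : IsJointlyProgressive F k)
    (hN : ∀ x, ∃ N, IsLocalMartingale F P N ∧
      (∀ ω t, ContinuousWithinAt (fun u => N u ω) (Ici t) t) ∧
      ∀ᵐ ω ∂P, Integrable (fun u => k x u ω * q x u ω) (κ ω) ∧
        ∀ t, N t ω = q x t ω * M t ω - ∫ u in Iic t, k x u ω * q x u ω ∂κ ω) (c : ℝ≥0) :
    Martingale (stoppedCompensated κ M (fun t ω => k (L ω) t ω) c) (enlargement F L hL) P := by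
  have h_snd : ∀ t, Measurable[(parametrized F).rightCont t, F t] (Prod.snd : ℝ × Ω → Ω) :=
    fun t => measurable_snd_parametrized.mono ((parametrized F).le_rightCont t) le_rfl
  have hk' : IsProgressive (parametrized F).rightCont fun t p => k p.1 t p.2 :=
    isProgressive_mono (Filtration.le_rightCont _) hk.isProgressive
  have hκ0' : ∀ (p : ℝ × Ω) t, κ p.2 {t} = 0 := fun p => hκ0 p.2
  have hMc' : ∀ p : ℝ × Ω, Continuous fun t => M t p.2 := fun p => hMc p.2
  have h_cont : ∀ p : ℝ × Ω, Continuous fun t => stoppedCompensated (fun p : ℝ × Ω => κ p.2)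
      (fun t p => M t p.2) (fun t p => k p.1 t p.2) c t p := fun p =>
    continuous_stoppedCompensated hκ0' hMc'
      ((measurable_uncurry_of_isProgressive hk').comp measurable_prodMk_left)
  refine martingale_enlargement_of_density hL hQ hq
    (measurable_stoppedCompensated (hκ.comp h_snd) hκ0'
      (fun t => (hM t).comp_measurable (h_snd t)) hMc' hk')
    (norm_stoppedCompensated_le hκ0' hMc') (fun p t => (h_cont p).continuousWithinAt) ?_
  intro x s t hst A hA
  obtain ⟨N, hN_loc, hN_cont, hN_eq⟩ := hN x
  let κ' : Kernel Ω (Time T) := ⟨κ, hκ.measurable⟩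
  have : ∀ ω, IsFiniteMeasure (κ' ω) := fun ω => inferInstanceAs (IsFiniteMeasure (κ ω))
  have hkx := isProgressive_section hk x
  exact setIntegral_mul_localized_sub (κ := κ') (hq.martingale x)
    (fun ω u => (hq.cadlag x ω u).1) (hq.nonneg x) hκ (isProgressive_of_continuous hM hMc) hkx
    (isStoppingTime_exitTime hκ hκ0 hM hMc hkx c) (isBoundedUpTo_exitTime hκ0 hMc c)
    hN_loc hN_cont hN_eq hst hA

end Enlargement

section MainTheorem

variable {T : ℝ≥0} {Ω : Type*} {mΩ : MeasurableSpace Ω} {F : Filtration (Time T) mΩ}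
  {P : Measure Ω} {C : Time T → Ω → ℝ}

lemma isAdaptedMeasure_pathMeasure (hC : StronglyAdapted F C)
    (hCc : ∀ ω, Continuous (fun t => C t ω) ∧ Monotone fun t => C t ω) :
    IsAdaptedMeasure F fun ω => pathMeasure fun t => C t ω := fun t => by
  simp only [fun ω => pathMeasure_Iic (hCc ω).1 (hCc ω).2]
  exact ((hC t).measurable.sub
    ((hC ⊥).measurable.mono (F.mono bot_le) le_rfl)).ennreal_ofReal

lemma setIntegral_Ioc_bot_eq {μ : Measure (Time T)} (hμ : μ {⊥} = 0) (f : Time T → ℝ)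
    (t : Time T) : ∫ u in Ioc ⊥ t, f u ∂μ = ∫ u in Iic t, f u ∂μ := by
  have h_Icc : Iic t = Icc ⊥ t := Icc_bot.symm
  rw [h_Icc]
  exact setIntegral_congr_set (Ioc_ae_eq_Icc' hμ)

lemma isCadlag_of_continuous {f : Time T → ℝ} (hf : Continuous f) : IsCadlag f := fun _ =>
  ⟨hf.continuousWithinAt, _, hf.continuousWithinAt⟩

lemma IsLocalMartingale.exists_isCadlag_modification {X : Time T → Ω → ℝ}
    (hF : ∀ S, P S = 0 → MeasurableSet[F ⊥] S) (hX : IsLocalMartingale F P X) :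
    ∃ Y, IsLocalMartingale F P Y ∧ (∀ ω, IsCadlag fun t => Y t ω) ∧
      ∀ᵐ ω ∂P, ∀ t, X t ω = Y t ω := by
  obtain ⟨Y, -, hY, hXY⟩ := exists_adapted_modification hF
    (isCadlag_of_continuous continuous_const) hX.adapted hX.cadlag
  exact ⟨Y, hX.congr_ae hF hXY, hY, hXY⟩

lemma continuous_boundedVariationOn_setIntegral_pathMeasure {c f : Time T → ℝ}
    (hc : Continuous c ∧ Monotone c) (hf : Integrable f (pathMeasure c)) :
    Continuous (fun t => ∫ s in Ioc ⊥ t, f s ∂pathMeasure c) ∧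
      BoundedVariationOn (fun t => ∫ s in Ioc ⊥ t, f s ∂pathMeasure c) univ := by
  have h_singleton : ∀ t, pathMeasure c {t} = 0 := pathMeasure_singleton hc.1 hc.2
  simp only [setIntegral_Ioc_bot_eq (h_singleton ⊥)]
  exact ⟨continuous_setIntegral_Iic h_singleton hf, boundedVariationOn_setIntegral_Iic hf⟩

variable [IsFiniteMeasure P] {L : Ω → ℝ} {Q : ∀ t : Time T, @Kernel Ω ℝ (F t) inferInstance}
  {q : ℝ → Time T → Ω → ℝ} {M : Time T → Ω → ℝ} {k : ℝ → Time T → Ω → ℝ}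

lemma enlargement_decomposition_of_atomless [F.IsRightContinuous] {κ : Ω → Measure (Time T)}
    [∀ ω, IsFiniteMeasure (κ ω)] (hL : Measurable L)
    (hQ : IsRegularCondLaw P L (F ⊤) (Q ⊤)) (hq : IsConditionalDensity P F L Q q)
    (hM : StronglyAdapted F M) (hMc : ∀ ω, Continuous fun t => M t ω)
    (hκ : IsAdaptedMeasure F κ) (hκ0 : ∀ ω t, κ ω {t} = 0) (hk : IsJointlyProgressive F k)
    (hN : ∀ x, ∃ N, IsLocalMartingale F P N ∧
      (∀ ω t, ContinuousWithinAt (fun u => N u ω) (Ici t) t) ∧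
      ∀ᵐ ω ∂P, Integrable (fun u => k x u ω * q x u ω) (κ ω) ∧
        ∀ t, N t ω = q x t ω * M t ω - ∫ u in Iic t, k x u ω * q x u ω ∂κ ω) :
    (∀ᵐ ω ∂P, Integrable (fun s => k (L ω) s ω) (κ ω)) ∧
      StronglyAdapted (enlargement F L hL) (fun t ω => ∫ s in Iic t, k (L ω) s ω ∂κ ω) ∧
      IsLocalMartingale (enlargement F L hL) P
        fun t ω => M t ω - ∫ s in Iic t, k (L ω) s ω ∂κ ω := by
  have h_int : ∀ x, ∀ᵐ ω ∂P, Integrable (fun s => k x s ω * q x s ω) (κ ω) := fun x =>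
    let ⟨_, _, _, h⟩ := hN x
    h.mono fun _ hω => hω.1
  have h_fin := ae_lintegral_substituted_lt_top hL hQ hq hκ hk h_int
  have hκL := hκ.mono (le_enlargement hL)
  have hML : StronglyAdapted (enlargement F L hL) M := fun t => (hM t).mono (le_enlargement hL t)
  have hkL := isProgressive_enlargement hL hk
  have : (enlargement F L hL).IsRightContinuous :=
    inferInstanceAs (Filtration.rightCont _).IsRightContinuous
  exact ⟨h_fin.mono fun ω hω => ⟨((measurable_uncurry_of_isProgressive hkL).comp
      measurable_prodMk_left).aestronglyMeasurable, hω⟩,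
    fun t => ((isProgressive_setIntegral_Iic hkL hκL).adapted t).stronglyMeasurable,
    isLocalMartingale_compensated hκL hκ0 hML hMc hkL h_fin fun n =>
      martingale_stoppedCompensated_enlargement hL hQ hq hκ hκ0 hM hMc hk hN n⟩

lemma enlargement_decomposition_of_continuous [F.IsRightContinuous]
    (hF : ∀ S, P S = 0 → MeasurableSet[F ⊥] S) (hL : Measurable L)
    (hQ : IsRegularCondLaw P L (F ⊤) (Q ⊤)) (hq : IsConditionalDensity P F L Q q)
    (hM : StronglyAdapted F M) (hMc : ∀ ω, Continuous fun t => M t ω)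
    (hC : StronglyAdapted F C) (hCc : ∀ ω, Continuous (fun t => C t ω) ∧ Monotone fun t => C t ω)
    (hk : IsJointlyProgressive F k)
    (h_int : ∀ x, ∀ᵐ ω ∂P, Integrable
      (fun s => k x s ω * Function.leftLim (fun u => q x u ω) s) (pathMeasure fun u => C u ω))
    (h_loc : ∀ x, IsLocalMartingale F P fun t ω => q x t ω * M t ω -
      ∫ s in Ioc ⊥ t, k x s ω * Function.leftLim (fun u => q x u ω) s
        ∂pathMeasure fun u => C u ω) :
    (∀ᵐ ω ∂P, Integrable (fun s => k (L ω) s ω) (pathMeasure fun u => C u ω)) ∧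
      StronglyAdapted (enlargement F L hL) (compensator k L C) ∧
      IsLocalMartingale (enlargement F L hL) P fun t ω => M t ω - compensator k L C t ω := by
  set κ : Ω → Measure (Time T) := fun ω => pathMeasure fun u => C u ω
  have hκ0 : ∀ ω t, κ ω {t} = 0 := fun ω => pathMeasure_singleton (hCc ω).1 (hCc ω).2
  have : ∀ ω, IsFiniteMeasure (κ ω) := fun ω => isFiniteMeasure_pathMeasure (hCc ω).1 (hCc ω).2
  have : ∀ ω, NullSingletonClass (κ ω) := fun ω => ⟨hκ0 ω⟩
  have h_left : ∀ x ω, (fun s => k x s ω * Function.leftLim (fun u => q x u ω) s) =ᵐ[κ ω]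
      fun s => k x s ω * q x s ω := fun x ω =>
    (EventuallyEq.refl _ _).mul ((hq.cadlag x ω).leftLim_ae_eq (κ ω))
  have h_comp : compensator k L C = fun t ω => ∫ s in Iic t, k (L ω) s ω ∂κ ω := by
    funext t ω
    exact setIntegral_Ioc_bot_eq (hκ0 ω ⊥) _ t
  rw [h_comp]
  refine enlargement_decomposition_of_atomless hL hQ hq hM hMc
    (isAdaptedMeasure_pathMeasure hC hCc) hκ0 hk fun x => ?_
  obtain ⟨N, hN_loc, hN_cadlag, hN⟩ := (h_loc x).exists_isCadlag_modification hF
  refine ⟨N, hN_loc, fun ω t => (hN_cadlag ω t).1, ?_⟩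
  filter_upwards [hN, h_int x] with ω hω h_int_ω
  refine ⟨h_int_ω.congr (h_left x ω), fun t => ?_⟩
  rw [← hω, setIntegral_Ioc_bot_eq (hκ0 ω ⊥), integral_congr_ae (ae_restrict_of_ae (h_left x ω))]

end MainTheorem

end InitialEnlargement

end

open InitialEnlargement in
theorem mainTheorem2_general {Ω : Type*} {mΩ : MeasurableSpace Ω} (P : Measure Ω)
    [IsFiniteMeasure P] (T : ℝ≥0) (F : Filtration (Time T) mΩ) (hF : UsualConditions F P)
    (L : Ω → ℝ) (hL : Measurable L) (Q : ∀ t : Time T, @Kernel Ω ℝ (F t) inferInstance)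
    (hQ : IsRegularCondLaw P L (F ⊤) (Q ⊤)) (q : ℝ → Time T → Ω → ℝ)
    (hq : IsConditionalDensity P F L Q q)
    (M : Time T → Ω → ℝ) (hM : StronglyAdapted F M)
    (hMc : ∀ᵐ ω ∂P, Continuous fun t => M t ω)
    (C : Time T → Ω → ℝ) (hC : StronglyAdapted F C)
    (hCc : ∀ᵐ ω ∂P, Continuous (fun t => C t ω) ∧ Monotone fun t => C t ω)
    (k : ℝ → Time T → Ω → ℝ) (hk : IsJointlyProgressive F k)
    (h_int : ∀ x, ∀ᵐ ω ∂P, Integrable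
      (fun s => k x s ω * Function.leftLim (fun u => q x u ω) s) (pathMeasure fun u => C u ω))
    (h_loc : ∀ x, IsLocalMartingale F P fun t ω => q x t ω * M t ω -
      ∫ s in Ioc ⊥ t, k x s ω * Function.leftLim (fun u => q x u ω) s
        ∂pathMeasure fun u => C u ω) :
    (∀ᵐ ω ∂P, Integrable (fun s => k (L ω) s ω) (pathMeasure fun u => C u ω)) ∧
      StronglyAdapted (enlargement F L hL) (compensator k L C) ∧
      (∀ᵐ ω ∂P, Continuous (fun t => compensator k L C t ω) ∧
        BoundedVariationOn (fun t => compensator k L C t ω) univ) ∧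
      IsLocalMartingale (enlargement F L hL) P fun t ω => M t ω - compensator k L C t ω := by
  have := hF.rightContinuous
  obtain ⟨M', hM', hMc', hMM'⟩ := exists_adapted_modification (p := Continuous)
    hF.complete continuous_const hM hMc
  obtain ⟨C', hC', hCc', hCC'⟩ := exists_adapted_modification
    (p := fun c => Continuous c ∧ Monotone c) hF.complete ⟨continuous_const, monotone_const⟩ hC hCc
  have h_path : ∀ᵐ ω ∂P, (fun t => C' t ω) = fun t => C t ω :=
    hCC'.mono fun ω hω => funext fun t => (hω t).symm
  have h_comp : ∀ᵐ ω ∂P, ∀ t, compensator k L C' t ω = compensator k L C t ω :=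
    h_path.mono fun ω hω t => by simp only [compensator, hω]
  obtain ⟨h_integrable, h_adapted, h_local⟩ := enlargement_decomposition_of_continuous
    hF.complete hL hQ hq hM' hMc' hC' hCc' hk
    (fun x => by filter_upwards [h_int x, h_path] with ω h hω; rwa [hω])
    (fun x => (h_loc x).congr_ae hF.complete <| by
      filter_upwards [hMM', h_path] with ω hω h_path_ω t
      simp only [h_path_ω, hω t])
  have hFL : ∀ S, P S = 0 → MeasurableSet[enlargement F L hL ⊥] S := fun S hS =>
    le_enlargement hL ⊥ S (hF.complete S hS)
  have h_integrable' : ∀ᵐ ω ∂P, Integrable (fun s => k (L ω) s ω) (pathMeasure fun u => C u ω) := by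
    filter_upwards [h_integrable, h_path] with ω h hω
    rwa [← hω]
  refine ⟨h_integrable', stronglyAdapted_of_ae_eq hFL h_adapted fun t => h_comp.mono fun ω h => h t,
    ?_, h_local.congr_ae hFL ?_⟩
  · filter_upwards [h_integrable', hCc] with ω h hω
    exact continuous_boundedVariationOn_setIntegral_pathMeasure hω h
  · filter_upwards [hMM', h_comp] with ω hω h_comp_ω t
    rw [hω, h_comp_ω]

theorem mainTheorem2 {Ω : Type*} {mΩ : MeasurableSpace Ω}
    (P : Measure Ω) [IsProbabilityMeasure P]
    (T : ℝ≥0) (hT : 0 < T)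
    (F : Filtration (InitialEnlargement.Time T) mΩ)
    (hF : InitialEnlargement.UsualConditions F P)
    (L : Ω → ℝ) (hL : Measurable L)
    (Q : ∀ t : InitialEnlargement.Time T, @Kernel Ω ℝ (F t) inferInstance)
    (hQ : ∀ t, InitialEnlargement.IsRegularCondLaw P L (F t) (Q t))
    (hA : InitialEnlargement.ConditionA P F Q)
    (q : ℝ → InitialEnlargement.Time T → Ω → ℝ)
    (hq : InitialEnlargement.IsConditionalDensity P F L Q q)
    (M : InitialEnlargement.Time T → Ω → ℝ)
    (hM : InitialEnlargement.IsLocalMartingale F P M)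
    (hMcont : ∀ᵐ ω ∂P, Continuous (fun t => M t ω))
    (C : InitialEnlargement.Time T → Ω → ℝ)
    (hC : InitialEnlargement.IsQuadraticVariation F P M C)
    (k : ℝ → InitialEnlargement.Time T → Ω → ℝ)
    (hk : InitialEnlargement.IsJointlyProgressive F k)
    (D : ℝ → InitialEnlargement.Time T → Ω → ℝ)
    (hD : ∀ x, InitialEnlargement.IsBracket F P (q x) M (D x))
    (hkD : ∀ x, ∀ᵐ ω ∂P,
      Integrable (fun s => k x s ω * Function.leftLim (fun u => q x u ω) s)
        (InitialEnlargement.pathMeasure (fun u => C u ω)) ∧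
      ∀ t, D x t ω = ∫ s in Ioc ⊥ t, k x s ω * Function.leftLim (fun u => q x u ω) s
        ∂(InitialEnlargement.pathMeasure (fun u => C u ω))) :
    (∀ᵐ ω ∂P, Integrable (fun s => k (L ω) s ω)
      (InitialEnlargement.pathMeasure (fun u => C u ω))) ∧
    StronglyAdapted (InitialEnlargement.enlargement F L hL)
      (InitialEnlargement.compensator k L C) ∧
    (∀ᵐ ω ∂P, Continuous (fun t => InitialEnlargement.compensator k L C t ω) ∧
      BoundedVariationOn (fun t => InitialEnlargement.compensator k L C t ω) univ) ∧
    InitialEnlargement.IsLocalMartingale (InitialEnlargement.enlargement F L hL) P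
      (fun t ω => M t ω - InitialEnlargement.compensator k L C t ω) := by
  have h_loc : ∀ x, InitialEnlargement.IsLocalMartingale F P fun t ω => q x t ω * M t ω -
      ∫ s in Ioc ⊥ t, k x s ω * Function.leftLim (fun u => q x u ω) s
        ∂InitialEnlargement.pathMeasure fun u => C u ω := fun x =>
    (hD x).isLocalMartingale.congr_ae hF.complete <| (hkD x).mono fun ω hω t => by rw [hω.2 t]
  exact mainTheorem2_general P T F hF L hL Q (hQ ⊤) q hq M hM.adapted hMcont C
    hC.predictable.stronglyAdapted (hC.continuous.and hC.monotone) k hk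
    (fun x => (hkD x).mono fun ω hω => hω.1) h_loc
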